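/- Let $\mathbb H$ be the quaternions, with $\mathbb H^2$ a right vector space on which matrices act from the left. A quaternionic system of imprimitivity of a group $G\subset GL_2(\mathbb H)$ is a set of at least two nonzero right $\mathbb H$-subspaces that is permuted by $G$ and has internal direct sum $\mathbb H^2$. For $q\in\mathbb H$, the system given by $(1,q)$ is $\{(1,q)\mathbb H,\ (-\overline q,1)\mathbb H\}$. Write $g^h=hgh^{-1}$, $\tau=\frac{1+\sqrt5}2$, $\sigma=1-\tau$, and let $$F=\tfrac1{\sqrt2}\begin{pmatrix}1&1\\1&-1\end{pmatrix},\quad R=\begin{pmatrix}1&0\\0&-i\end{pmatrix},\quad A=R^2=\begin{pmatrix}1&0\\0&-1\end{pmatrix},\quad Z=\tfrac{1+\sqrt3+(\sqrt3-1)i}{4}\begin{pmatrix}1&1\\-i&i\end{pmatrix},$$ $$M=\Bigl(-\tfrac\tau4+\tfrac{\sqrt{1-\tau^2/4}}2\,i\Bigr)\begin{pmatrix}-\tau+i&\sigma\\-\sigma&-\tau-i\end{pmatrix}.$$ The $19$ primitive complex reflection groups of rank two are, up to conjugation in $GL_2(\mathbb C)$, the Shephard–Todd groups $G_4=\langle Z,Z^A\rangle$,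 $G_5=\langle Z,Z^F\rangle$, $G_6=\langle A,Z\rangle$, $G_7=\langle A,Z,Z^F\rangle$ (tetrahedral); $G_8=\langle R,R^F\rangle$, $G_9=\langle F,R\rangle$, $G_{10}=\langle R,Z\rangle$, $G_{11}=\langle F,R,Z\rangle$, $G_{12}=\langle F,F^Z,F^{Z^2}\rangle$, $G_{13}=\langle F,F^Z,R^2\rangle$, $G_{14}=\langle F,Z\rangle$, $G_{15}=\langle F,A,Z\rangle$ (octahedral); $G_{16}=\langle M,M^A\rangle$, $G_{17}=\langle A,M\rangle$, $G_{18}=\langle Z,M\rangle$, $G_{19}=\langle A,Z,M\rangle$, $G_{20}=\langle Z,Z^M\rangle$, $G_{21}=\langle A,Z,A^M\rangle$, $G_{22}=\langle A,A^Z,A^M\rangle$ (icosahedral). For a set $S$ of unit quaternions, let $L(S)$ be the closure of $S$ under $(a,b)\mapsto ab^{-1}a$, and put $$L_{12}^{\mathcal T}=L\bigl(\{1,i,\tfrac{1+i+j+k}2\}\bigr),\quad L_{18}^{\mathcal O}=L\bigl(\{1,\tfrac{1+i}{\sqrt2},\tfrac{1+i+j+k}2\}\bigr),\quad L_{30}^{\mathcal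 I}=L\bigl(\{1,\tfrac{1+i+j+k}2,\tfrac{\tau+\sigma i-j}2\}\bigr).$$ For $L$ one of these, let $K\in\{\mathcal T,\mathcal O,\mathcal I\}$ (binary tetrahedral, octahedral or icosahedral) be the group generated by $L$, and let $G_K(L,1)\subset GL_2(\mathbb H)$ be the imprimitive quaternionic reflection group generated by the reflections $\begin{pmatrix}0&b\\\overline b&0\end{pmatrix}$, $b\in L$. Theorem. (1) For $4\le n\le 22$, the group $G_n$ (and equally each of its conjugates in $GL_2(\mathbb C)$), viewed as a group of matrices over $\mathbb H$, has a quaternionic system of imprimitivity if and only if $n\in\{12,13,22\}$. So the other $16$ groups have none. (2) For each of $G_{12},G_{13},G_{22}$, the quaternionic systems of imprimitivity are precisely the systems given by $(1,zj)$, $z\in\mathbb C$, $|z|=1$. (3) For every $z\in\mathbb C$ with $|z|=1$ and each $n\in\{12,13,22\}$ there is a unitary change of basis matrix $U$, with first column in $(1,zj)\mathbb H$ and second column in $(zj,1)\mathbb H$, such that $$U^{-1}G_{n}U=G_{\mathcal T}(L_{12}^{\mathcal T},1),\quad G_{\mathcal O}(L_{18}^{\mathcal O},1),\quad G_{\mathcal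 I}(L_{30}^{\mathcal I},1)\qquad\text{for } n=12,\,13,\,22,\text{ respectively.}$$ -/

import Mathlib

open Matrix Quaternion

noncomputable section

namespace QuatImprim

/-! ### Systems of imprimitivity

`D ^ d` is a right vector space over the division ring `D`, that is, a module over `Dᵐᵒᵖ`,
and matrices act on the left. -/

/-- The right `D`-linear map `v ↦ A v` on column vectors. -/
def mulVecRight {D : Type*} [DivisionRing D] {d : ℕ} (A : Matrix (Fin d) (Fin d) D) :
    (Fin d → D) →ₗ[Dᵐᵒᵖ] (Fin d → D) where
  toFun v := A *ᵥ v
  map_add' := A.mulVec_add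
  map_smul' c v := A.mulVec_smul c v

/-- A set of at least two nonzero right subspaces, whose internal direct sum is the whole space
(they are independent and span), and which is permuted by the group `G`. -/
structure IsSystemOfImprimitivity {D : Type*} [DivisionRing D] {d : ℕ}
    (G : Subgroup (GL (Fin d) D)) (𝒱 : Set (Submodule Dᵐᵒᵖ (Fin d → D))) : Prop where
  two_le : 2 ≤ 𝒱.encard
  ne_bot : ∀ V ∈ 𝒱, V ≠ ⊥
  indep : sSupIndep 𝒱
  span : sSup 𝒱 = ⊤
  permutes : ∀ g ∈ G, (fun V => V.map (mulVecRight (g : Matrix (Fin d) (Fin d) D))) '' 𝒱 = 𝒱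

/-- The right line `v D`. -/
def line {D : Type*} [DivisionRing D] {d : ℕ} (v : Fin d → D) : Submodule Dᵐᵒᵖ (Fin d → D) :=
  Submodule.span Dᵐᵒᵖ {v}

/-- The orthogonal system given by `(1, q)`: the lines of `(1, q)` and `(-q̄, 1)`. -/
def orthogonalSystem (q : ℍ[ℝ]) : Set (Submodule ℍ[ℝ]ᵐᵒᵖ (Fin 2 → ℍ[ℝ])) :=
  {line ![1, q], line ![-star q, 1]}

/-- `U` is a unitary change of basis matrix for the orthogonal system given by `(1, q)`:
its columns are an orthonormal basis of `ℍ²`, taken from the two lines of the system. -/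
structure IsChangeOfBasis (q : ℍ[ℝ]) (U : GL (Fin 2) ℍ[ℝ]) : Prop where
  mem_unitary : (U : Matrix (Fin 2) (Fin 2) ℍ[ℝ]) ∈ unitary (Matrix (Fin 2) (Fin 2) ℍ[ℝ])
  col_zero : (U : Matrix (Fin 2) (Fin 2) ℍ[ℝ]).col 0 ∈ line ![1, q]
  col_one : (U : Matrix (Fin 2) (Fin 2) ℍ[ℝ]).col 1 ∈ line ![-star q, 1]

/-- The quaternion `z j`, for complex `z`. -/
def mulJ (z : ℂ) : ℍ[ℝ] := (z : ℍ[ℝ]) * ⟨0, 0, 1, 0⟩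

/-- The conjugate `U⁻¹ G U`, that is, `G` written in the basis of columns of `U`. -/
def changeBasis {D : Type*} [DivisionRing D] {d : ℕ} (U : GL (Fin d) D)
    (G : Subgroup (GL (Fin d) D)) : Subgroup (GL (Fin d) D) :=
  G.map (MulAut.conj U⁻¹).toMonoidHom

/-- A group of complex matrices, viewed as a group of quaternionic matrices. -/
def toQuat {d : ℕ} (G : Subgroup (GL (Fin d) ℂ)) : Subgroup (GL (Fin d) ℍ[ℝ]) :=
  G.map (Units.map (RingHom.mapMatrix (Quaternion.ofComplex : ℂ →+* ℍ[ℝ])).toMonoidHom)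

/-! ### The primitive complex reflection groups of rank two -/

/-- The golden ratio `τ`. -/
def τ : ℝ := (1 + √5) / 2

/-- `σ = 1 - τ`. -/
def σ : ℝ := 1 - τ

/-- Reflection of order two. -/
def F : GL (Fin 2) ℂ :=
  GeneralLinearGroup.mkOfDetNeZero (((1 / √2 : ℝ) : ℂ) • !![1, 1; 1, -1]) (by
    rw [det_smul, det_fin_two_of]
    norm_num)

/-- Reflection of order four. -/
def R : GL (Fin 2) ℂ :=
  GeneralLinearGroup.mkOfDetNeZero !![1, 0; 0, -Complex.I] (by
    rw [det_fin_two_of]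
    simp)

/-- Reflection of order three; it equals `exp (2 π i / 24) R F`. -/
def Z : GL (Fin 2) ℂ :=
  GeneralLinearGroup.mkOfDetNeZero
    ((⟨(1 + √3) / 4, (√3 - 1) / 4⟩ : ℂ) • !![1, 1; -Complex.I, Complex.I]) (by
    have h : (⟨(1 + √3) / 4, (√3 - 1) / 4⟩ : ℂ) ≠ 0 := fun h => by
      have := congrArg Complex.re h
      have h3 := Real.sqrt_nonneg 3
      simp only [Complex.zero_re] at this
      linarith
    rw [det_smul, det_fin_two_of]
    refine mul_ne_zero (pow_ne_zero _ h) ?_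
    intro h2
    have := congrArg Complex.im h2
    norm_num at this)

/-- Reflection of order two. -/
def A : GL (Fin 2) ℂ :=
  GeneralLinearGroup.mkOfDetNeZero !![1, 0; 0, -1] (by
    rw [det_fin_two_of]
    simp)

/-- Reflection of order five. -/
def M : GL (Fin 2) ℂ :=
  GeneralLinearGroup.mkOfDetNeZero
    ((⟨-τ / 4, √(1 - τ ^ 2 / 4) / 2⟩ : ℂ) •
      !![-τ + Complex.I, (σ : ℂ); -σ, -τ - Complex.I]) (by
    have h : (⟨-τ / 4, √(1 - τ ^ 2 / 4) / 2⟩ : ℂ) ≠ 0 := fun h => by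
      have := congrArg Complex.re h
      have h3 := Real.sqrt_nonneg 5
      simp only [Complex.zero_re, τ] at this
      linarith
    rw [det_smul, det_fin_two_of]
    refine mul_ne_zero (pow_ne_zero _ h) ?_
    have h1 : ((-τ : ℂ) + Complex.I) * (-τ - Complex.I) - σ * -σ
        = ((τ ^ 2 + 1 + σ ^ 2 : ℝ) : ℂ) := by
      push_cast
      linear_combination - Complex.I_sq
    rw [h1, Ne, Complex.ofReal_eq_zero]
    positivity)

/-- The conjugate `h g h⁻¹`, written `g ^ h` in the literature. -/
def cj (g h : GL (Fin 2) ℂ) : GL (Fin 2) ℂ := h * g * h⁻¹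

/-- Generating reflections for the Shephard-Todd groups `G₄, …, G₂₂`. -/
def shephardToddGens : ℕ → Set (GL (Fin 2) ℂ)
  -- tetrahedral type
  | 4 => {Z, cj Z A}
  | 5 => {Z, cj Z F}
  | 6 => {A, Z}
  | 7 => {A, Z, cj Z F}
  -- octahedral type
  | 8 => {R, cj R F}
  | 9 => {F, R}
  | 10 => {R, Z}
  | 11 => {F, R, Z}
  | 12 => {F, cj F Z, cj F (Z ^ 2)}
  | 13 => {F, cj F Z, R ^ 2}
  | 14 => {F, Z}
  | 15 => {F, A, Z}
  -- icosahedral type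
  | 16 => {M, cj M A}
  | 17 => {A, M}
  | 18 => {Z, M}
  | 19 => {A, Z, M}
  | 20 => {Z, cj Z M}
  | 21 => {A, Z, cj A M}
  | 22 => {A, cj A Z, cj A M}
  | _ => ∅

/-- The Shephard-Todd group `Gₙ`, for `4 ≤ n ≤ 22`. -/
def shephardTodd (n : ℕ) : Subgroup (GL (Fin 2) ℂ) :=
  Subgroup.closure (shephardToddGens n)

/-! ### The imprimitive quaternionic reflection groups -/

/-- The reflection system generated by `S`: its closure under `a ∘ b = a b⁻¹ a`. -/
inductive reflectionSystem (S : Set ℍ[ℝ]) : Set ℍ[ℝ]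
  | of {a : ℍ[ℝ]} : a ∈ S → reflectionSystem S a
  | circ {a b : ℍ[ℝ]} : reflectionSystem S a → reflectionSystem S b →
      reflectionSystem S (a * b⁻¹ * a)

/-- The imprimitive reflection group `G_K(L, H)`, generated by the reflections
`(0 b; b̄ 0)` with `b ∈ L` and `(h 0; 0 1)`, `(1 0; 0 h)` with `h ∈ H \ {1}`.
Here `L` is a reflection system of unit quaternions containing `1`; the group `K` is the group
that `L` generates, and so is not an argument. -/
def imprimitiveGroup (L H : Set ℍ[ℝ]) : Subgroup (GL (Fin 2) ℍ[ℝ]) :=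
  Subgroup.closure
    ({g | ∃ b ∈ L, (g : Matrix (Fin 2) (Fin 2) ℍ[ℝ]) = !![0, b; star b, 0]} ∪
      {g | ∃ h ∈ H \ {1}, (g : Matrix (Fin 2) (Fin 2) ℍ[ℝ]) = !![h, 0; 0, 1] ∨
        (g : Matrix (Fin 2) (Fin 2) ℍ[ℝ]) = !![1, 0; 0, h]})

/-- The reflection system `L₁₂` for the binary tetrahedral group, generated by
`1, i, (1 + i + j + k) / 2`. -/
def L12T : Set ℍ[ℝ] :=
  reflectionSystem {1, ⟨0, 1, 0, 0⟩, ⟨1 / 2, 1 / 2, 1 / 2, 1 / 2⟩}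

/-- The reflection system `L₁₈` for the binary octahedral group, generated by
`1, (1 + i) / √2, (1 + i + j + k) / 2`. -/
def L18O : Set ℍ[ℝ] :=
  reflectionSystem {1, ⟨1 / √2, 1 / √2, 0, 0⟩, ⟨1 / 2, 1 / 2, 1 / 2, 1 / 2⟩}

/-- The reflection system `L₃₀` for the binary icosahedral group, generated by
`1, (1 + i + j + k) / 2, (τ + σ i - j) / 2`. -/
def L30I : Set ℍ[ℝ] :=
  reflectionSystem {1, ⟨1 / 2, 1 / 2, 1 / 2, 1 / 2⟩, ⟨τ / 2, σ / 2, -1 / 2, 0⟩}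

end QuatImprim

end

/-! A system of imprimitivity of `D²` is a pair of lines, and each group element fixes both or swaps
them, so squares fix both. Such a line over `ℍ` is either spanned by a complex vector or is `(1,
q)ℍ` with `q = u + w j`, `w ≠ 0`. The first kind would give a common eigenvector of two elements of
nonzero trace, hence a singular commutator; an explicit `IsPrimitivePair` in each group excludes
this. For the second kind, invariance of `(1, q)ℍ` under a complex `g` is a Riccati equation
(`riccati`), which makes `det g` a positive norm (`det_of_fixes`). So `(det g)² > 0` for all `g` in
the group, and an element of nonreal determinant rules out sixteen of the groups.

The other three are generated by traceless Hermitian reflections, with roots `(a, x, y)` on the unit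
sphere. Their determinant is `-1`, so they swap the two lines, and products of two of them fix both.
Two such products with independent off-diagonal entries force `u = 0` and `|w| = 1`. Conversely,
every traceless Hermitian reflection swaps the lines of `(1, z j)` and `(z j, 1)` when `|z| = 1`.

In an orthonormal basis `(1, z j)X`, `(z j, 1)Y`, the reflection with root `(a, x, y)` becomes
antidiagonal with entry `2 X̄ (x + y i + a z j) Y`. Left and right multiplications realise the
rotations of `ℝ⁴`, so it suffices to find generating reflections whose roots have the same Gram
matrix as the generators of `L`, together with suitable `X` and `Y`. -/

noncomputable section

namespace QuatImprim

/-! ### Right subspaces and systems of imprimitivity over a division ring -/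

section DivisionRing

variable {D : Type*} [DivisionRing D] {d : ℕ}

lemma map_mulVecRight_mul (A B : Matrix (Fin d) (Fin d) D) (V : Submodule Dᵐᵒᵖ (Fin d → D)) :
    V.map (mulVecRight (A * B)) = (V.map (mulVecRight B)).map (mulVecRight A) := by
  rw [← Submodule.map_comp]
  congr 1
  exact LinearMap.ext fun v => (Matrix.mulVec_mulVec v A B).symm

lemma map_mulVecRight_one (V : Submodule Dᵐᵒᵖ (Fin d → D)) :
    V.map (mulVecRight (1 : Matrix (Fin d) (Fin d) D)) = V := by
  have : mulVecRight (1 : Matrix (Fin d) (Fin d) D) = LinearMap.id :=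
    LinearMap.ext fun v => Matrix.one_mulVec v
  rw [this, Submodule.map_id]

/-- The automorphism `V ↦ g V` of the lattice of right subspaces. -/
def subspaceIso (g : GL (Fin d) D) :
    Submodule Dᵐᵒᵖ (Fin d → D) ≃o Submodule Dᵐᵒᵖ (Fin d → D) where
  toFun V := V.map (mulVecRight (g : Matrix (Fin d) (Fin d) D))
  invFun V := V.map (mulVecRight ((g⁻¹ : GL (Fin d) D) : Matrix (Fin d) (Fin d) D))
  left_inv V := by
    simp only [← map_mulVecRight_mul, Units.inv_mul, map_mulVecRight_one]
  right_inv V := by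
    simp only [← map_mulVecRight_mul, Units.mul_inv, map_mulVecRight_one]
  map_rel_iff' {V W} := by
    refine ⟨fun h => ?_, fun h => Submodule.map_mono h⟩
    have := Submodule.map_mono
      (f := mulVecRight ((g⁻¹ : GL (Fin d) D) : Matrix (Fin d) (Fin d) D)) h
    simpa only [Equiv.coe_fn_mk, ← map_mulVecRight_mul, Units.inv_mul,
      map_mulVecRight_one] using this

lemma subspaceIso_apply (g : GL (Fin d) D) (V : Submodule Dᵐᵒᵖ (Fin d → D)) :
    subspaceIso g V = V.map (mulVecRight (g : Matrix (Fin d) (Fin d) D)) := rfl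

lemma subspaceIso_mul (g h : GL (Fin d) D) (V : Submodule Dᵐᵒᵖ (Fin d → D)) :
    subspaceIso (g * h) V = subspaceIso g (subspaceIso h V) :=
  map_mulVecRight_mul _ _ _

lemma subspaceIso_one (V : Submodule Dᵐᵒᵖ (Fin d → D)) :
    subspaceIso (1 : GL (Fin d) D) V = V :=
  map_mulVecRight_one _

lemma subspaceIso_line (g : GL (Fin d) D) (v : Fin d → D) :
    subspaceIso g (line v) = line ((g : Matrix (Fin d) (Fin d) D) *ᵥ v) := by
  rw [subspaceIso_apply, line, line, Submodule.map_span, Set.image_singleton]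
  rfl

lemma mem_line_iff {v w : Fin d → D} : w ∈ line v ↔ ∃ c : D, (fun i => v i * c) = w := by
  rw [line, Submodule.mem_span_singleton]
  exact ⟨fun ⟨c, hc⟩ => ⟨c.unop, hc⟩, fun ⟨c, hc⟩ => ⟨MulOpposite.op c, hc⟩⟩

lemma exists_of_line_eq {v w : Fin d → D} (h : line w = line v) :
    ∃ c : D, (fun i => v i * c) = w :=
  mem_line_iff.1 (h.le (Submodule.mem_span_singleton_self w))

lemma line_eq_of_mem {v w : Fin d → D} (hw : w ≠ 0) (h : w ∈ line v) : line w = line v := by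
  obtain ⟨c, rfl⟩ := mem_line_iff.1 h
  have hc : c ≠ 0 := by
    rintro rfl
    exact hw (by ext; simp)
  refine le_antisymm ((Submodule.span_singleton_le_iff_mem _ _).2 h)
    ((Submodule.span_singleton_le_iff_mem _ _).2 (mem_line_iff.2 ⟨c⁻¹, ?_⟩))
  ext i
  simp [hc]

/-- All the conditions are lattice-theoretic, so the order isomorphism `V ↦ U⁻¹ V` transports them.
-/
lemma IsSystemOfImprimitivity.map {G : Subgroup (GL (Fin d) D)}
    {𝒱 : Set (Submodule Dᵐᵒᵖ (Fin d → D))} (h : IsSystemOfImprimitivity G 𝒱) (U : GL (Fin d) D) :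
    IsSystemOfImprimitivity (changeBasis U G) (subspaceIso U⁻¹ '' 𝒱) where
  two_le := by
    rw [(subspaceIso U⁻¹).injective.encard_image]
    exact h.two_le
  ne_bot := by
    rintro _ ⟨V, hV, rfl⟩
    simpa using h.ne_bot V hV
  indep := by
    rintro _ ⟨V, hV, rfl⟩
    have h1 := h.indep hV
    rw [← Set.image_singleton, ← Set.image_sdiff (subspaceIso U⁻¹).injective, sSup_image,
      ← OrderIso.map_sSup]
    exact h1.map_orderIso (subspaceIso U⁻¹)
  span := by
    rw [sSup_image, ← OrderIso.map_sSup, h.span, OrderIso.map_top]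
  permutes := by
    rintro _ ⟨g, hg, rfl⟩
    change subspaceIso _ '' _ = _
    have h1 : subspaceIso g '' 𝒱 = 𝒱 := h.permutes g hg
    conv_rhs => rw [← h1]
    rw [Set.image_image, Set.image_image]
    refine Set.image_congr fun V _ => ?_
    rw [← subspaceIso_mul, ← subspaceIso_mul]
    simp

lemma finrank_op_self : Module.finrank Dᵐᵒᵖ D = 1 :=
  finrank_eq_one (R := Dᵐᵒᵖ) (1 : D) one_ne_zero fun w => ⟨MulOpposite.op w, by simp⟩

instance : Module.Finite Dᵐᵒᵖ D :=
  Module.finite_of_finrank_eq_succ (n := 0) finrank_op_self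

lemma finrank_op_fin_two : Module.finrank Dᵐᵒᵖ (Fin 2 → D) = 2 := by
  rw [Module.finrank_pi_fintype]
  simp [finrank_op_self]

/-- A system of imprimitivity of `D²` consists of two lines. -/
lemma IsSystemOfImprimitivity.exists_eq_pair {G : Subgroup (GL (Fin 2) D)}
    {𝒱 : Set (Submodule Dᵐᵒᵖ (Fin 2 → D))} (h : IsSystemOfImprimitivity G 𝒱) :
    ∃ v w : Fin 2 → D, v ≠ 0 ∧ line v ≠ line w ∧ 𝒱 = {line v, line w} := by
  have h2 : 1 < 𝒱.encard := lt_of_lt_of_le (by norm_num) h.two_le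
  obtain ⟨V, W, hV, hW, hVW⟩ := Set.one_lt_encard_iff.1 h2
  have hdis : Disjoint V W :=
    (h.indep hV).mono_right (le_sSup (show W ∈ 𝒱 \ {V} from ⟨hW, fun e => hVW e.symm⟩))
  have hpos : ∀ X ∈ 𝒱, 0 < Module.finrank Dᵐᵒᵖ X := fun X hX => by
    rw [Nat.pos_iff_ne_zero, Ne, Submodule.finrank_eq_zero]
    exact h.ne_bot X hX
  -- Two positive dimensions with sum at most 2 are both 1.
  have hsum := Submodule.finrank_add_finrank_le_of_disjoint hdis
  rw [finrank_op_fin_two] at hsum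
  have hVp := hpos V hV
  have hWp := hpos W hW
  have hline : ∀ X : Submodule Dᵐᵒᵖ (Fin 2 → D), Module.finrank Dᵐᵒᵖ X = 1 →
      ∃ v, v ≠ 0 ∧ X = line v := fun X hX => by
    obtain ⟨⟨v, hv⟩, hv0, hall⟩ := finrank_eq_one_iff'.1 hX
    refine ⟨v, fun e => hv0 (by simpa using e), le_antisymm (fun w hw => ?_) ?_⟩
    · obtain ⟨c, hc⟩ := hall ⟨w, hw⟩
      exact Submodule.mem_span_singleton.2 ⟨c, congrArg Subtype.val hc⟩
    · exact (Submodule.span_singleton_le_iff_mem _ _).2 hv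
  obtain ⟨v, hv0, rfl⟩ := hline V (by omega)
  obtain ⟨w, -, rfl⟩ := hline W (by omega)
  have htop : line v ⊔ line w = ⊤ := by
    apply Submodule.eq_top_of_finrank_eq
    have := Submodule.finrank_sup_add_finrank_inf_eq (line v) (line w)
    rw [hdis.eq_bot, finrank_bot] at this
    rw [finrank_op_fin_two]
    omega
  refine ⟨v, w, hv0, hVW, Set.Subset.antisymm (fun X hX => ?_) ?_⟩
  -- A third member would be disjoint from the sum of the two lines, which is everything, and so
  -- would be zero.
  · by_contra hne
    simp only [Set.mem_insert_iff, Set.mem_singleton_iff, not_or] at hne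
    have hd := (h.indep hX).mono_right (sup_le
      (le_sSup (show line v ∈ 𝒱 \ {X} from ⟨hV, fun e => hne.1 e.symm⟩))
      (le_sSup (show line w ∈ 𝒱 \ {X} from ⟨hW, fun e => hne.2 e.symm⟩)))
    rw [htop, disjoint_top] at hd
    exact h.ne_bot X hX hd
  · rintro X (rfl | rfl)
    exacts [hV, hW]

lemma fixes_or_swaps {g : GL (Fin d) D} {V W : Submodule Dᵐᵒᵖ (Fin d → D)} (hVW : V ≠ W)
    (h : subspaceIso g '' {V, W} = {V, W}) :
    subspaceIso g V = V ∨ subspaceIso g V = W ∧ subspaceIso g W = V := by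
  have h1 : subspaceIso g V ∈ ({V, W} : Set _) := h ▸ Set.mem_image_of_mem _ (by simp)
  have h2 : subspaceIso g W ∈ ({V, W} : Set _) := h ▸ Set.mem_image_of_mem _ (by simp)
  rcases h1 with h1 | h1
  · exact Or.inl h1
  · rcases h2 with h2 | h2
    · exact Or.inr ⟨h1, h2⟩
    · exact absurd ((subspaceIso g).injective (h1.trans h2.symm)) hVW

end DivisionRing

/-! ### Quaternionic lines fixed by complex matrices -/

section ComplexMatrices

/-- A complex matrix, viewed as a quaternionic matrix. -/
def quatHom : GL (Fin 2) ℂ →* GL (Fin 2) ℍ[ℝ] :=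
  Units.map (RingHom.mapMatrix (Quaternion.ofComplex : ℂ →+* ℍ[ℝ])).toMonoidHom

lemma toQuat_eq_map (G : Subgroup (GL (Fin 2) ℂ)) : toQuat G = G.map quatHom := rfl

lemma quatHom_apply (g : GL (Fin 2) ℂ) (i j : Fin 2) :
    (quatHom g : Matrix (Fin 2) (Fin 2) ℍ[ℝ]) i j = ((g i j : ℂ) : ℍ[ℝ]) := rfl

lemma coe_quatHom (g : GL (Fin 2) ℂ) :
    (quatHom g : Matrix (Fin 2) (Fin 2) ℍ[ℝ]) =
      !![((g 0 0 : ℂ) : ℍ[ℝ]), ((g 0 1 : ℂ) : ℍ[ℝ]);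
        ((g 1 0 : ℂ) : ℍ[ℝ]), ((g 1 1 : ℂ) : ℍ[ℝ])] := by
  ext1 i j
  rw [quatHom_apply]
  fin_cases i <;> fin_cases j <;> rfl

lemma changeBasis_toQuat (P : GL (Fin 2) ℂ) (G : Subgroup (GL (Fin 2) ℂ)) :
    toQuat (changeBasis P G) = changeBasis (quatHom P) (toQuat G) := by
  rw [toQuat_eq_map, toQuat_eq_map, changeBasis, changeBasis, Subgroup.map_map, Subgroup.map_map]
  congr 1
  ext1 g
  simp

/-- The complex component `u` of `q = u + w j`. -/
def cfst (q : ℍ[ℝ]) : ℂ := ⟨q.re, q.imI⟩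

/-- The complex component `w` of `q = u + w j`. -/
def csnd (q : ℍ[ℝ]) : ℂ := ⟨q.imJ, q.imK⟩

lemma cfst_coe_mul (x : ℂ) (q : ℍ[ℝ]) : cfst (x * q) = x * cfst q := by
  apply Complex.ext <;> simp [cfst]

lemma cfst_coe (x : ℂ) : cfst x = x := by
  apply Complex.ext <;> simp [cfst]

lemma coe_cfst_of_csnd_eq_zero {q : ℍ[ℝ]} (h : csnd q = 0) : ((cfst q : ℂ) : ℍ[ℝ]) = q := by
  have h2 := congrArg Complex.re h
  have h3 := congrArg Complex.im h
  simp only [csnd, Complex.zero_re, Complex.zero_im] at h2 h3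
  ext <;> simp [cfst, h2, h3]

/-- A nonzero vector spans the line of a complex vector, or that of `(1, u + w j)`, `w ≠ 0`. -/
lemma line_complex_or {v : Fin 2 → ℍ[ℝ]} (hv : v ≠ 0) :
    (∃ x : Fin 2 → ℂ, x ≠ 0 ∧ line v = line fun i => ((x i : ℂ) : ℍ[ℝ])) ∨
      ∃ q, csnd q ≠ 0 ∧ line v = line ![1, q] := by
  have key : ∀ w : Fin 2 → ℍ[ℝ], ∀ c : ℍ[ℝ], (∀ i, w i * c = v i) → line v = line w :=
    fun w c h => line_eq_of_mem hv (mem_line_iff.2 ⟨c, funext h⟩)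
  by_cases h0 : v 0 = 0
  · refine Or.inl ⟨![0, 1], fun e => by simpa using congrFun e 1, key _ (v 1) fun i => ?_⟩
    fin_cases i <;> simp [h0]
  · have hq : line v = line ![1, v 1 * (v 0)⁻¹] := key _ (v 0) fun i => by
      fin_cases i <;> simp [h0]
    by_cases hs : csnd (v 1 * (v 0)⁻¹) = 0
    · refine Or.inl ⟨![1, cfst (v 1 * (v 0)⁻¹)], fun e => by simpa using congrFun e 0, ?_⟩
      rw [hq]
      congr 1
      ext1 i
      fin_cases i
      · simp
      · simpa using (coe_cfst_of_csnd_eq_zero hs).symm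
    · exact Or.inr ⟨_, hs, hq⟩

/-- The multiplier on the line is a priori a quaternion; since `cfst` is left `ℂ`-linear, its
complex component is an eigenvalue. -/
lemma eigenvector_of_fixes_complex_line {g : GL (Fin 2) ℂ} {x : Fin 2 → ℂ}
    (h : subspaceIso (quatHom g) (line fun i => ((x i : ℂ) : ℍ[ℝ])) =
      line fun i => ((x i : ℂ) : ℍ[ℝ])) :
    ∃ μ : ℂ, (g : Matrix (Fin 2) (Fin 2) ℂ) *ᵥ x = μ • x := by
  rw [subspaceIso_line] at h
  obtain ⟨c, hc⟩ := exists_of_line_eq h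
  refine ⟨cfst c, funext fun i => ?_⟩
  have h1 := congrArg cfst (congrFun hc i)
  rw [cfst_coe_mul] at h1
  have h2 : ((quatHom g : Matrix (Fin 2) (Fin 2) ℍ[ℝ]) *ᵥ fun i => ((x i : ℂ) : ℍ[ℝ])) i =
      (((g : Matrix (Fin 2) (Fin 2) ℂ) *ᵥ x) i : ℂ) := by
    simp [Matrix.mulVec, dotProduct, quatHom_apply]
  rw [h2, cfst_coe] at h1
  rw [← h1, Pi.smul_apply, smul_eq_mul, mul_comm]

/-- An element of `GL₂(ℂ)` fixes the line of `(1, u + w j)`, `w ≠ 0`, only if its entries satisfy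
the two components of a Riccati equation. -/
lemma riccati {g : GL (Fin 2) ℂ} {q : ℍ[ℝ]} (hq : csnd q ≠ 0)
    (h : subspaceIso (quatHom g) (line ![1, q]) = line ![1, q]) :
    cfst q * g 0 0 + g 0 1 * cfst q ^ 2 - csnd q * star (csnd q) * star (g 0 1) =
        g 1 0 + g 1 1 * cfst q ∧
      star (g 0 0) + g 0 1 * cfst q + star (g 0 1) * star (cfst q) = g 1 1 := by
  rw [subspaceIso_line] at h
  obtain ⟨c, hc⟩ := exists_of_line_eq h
  have h0 := congrFun hc 0
  have h1 := congrFun hc 1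
  rw [coe_quatHom] at h0 h1
  simp only [Matrix.mulVec, dotProduct, Fin.sum_univ_two, Matrix.of_apply, Matrix.cons_val_zero,
    Matrix.cons_val_one, one_mul, mul_one] at h0 h1
  -- The first coordinate gives the multiplier `c = g₀₀ + g₀₁ q`, so the second becomes `q (g₀₀ +
  -- g₀₁ q) = g₁₀ + g₁₁ q`.
  rw [h0] at h1
  have e := Quaternion.ext_iff.1 h1
  simp at e
  obtain ⟨e0, e1, e2, e3⟩ := e
  constructor
  · apply Complex.ext
    · simp [cfst, csnd, pow_two]
      linear_combination e0
    · simp [cfst, csnd, pow_two]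
      linear_combination e1
  -- Every term of the `j`-component contains the factor `w`.
  · refine mul_left_cancel₀ hq (Complex.ext ?_ ?_)
    · simp [cfst, csnd]
      linear_combination e2
    · simp [cfst, csnd]
      linear_combination e3

/-- The Riccati equation identifies `det g` with the norm `|g₀₀ + g₀₁ u|² + |w g₀₁|²` of the
multiplier `c = g₀₀ + g₀₁ q`. -/
lemma det_of_fixes {g : GL (Fin 2) ℂ} {q : ℍ[ℝ]} (hq : csnd q ≠ 0)
    (h : subspaceIso (quatHom g) (line ![1, q]) = line ![1, q]) :
    ∃ r : ℝ, 0 < r ∧ (g : Matrix (Fin 2) (Fin 2) ℂ).det = r := by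
  obtain ⟨h1, h2⟩ := riccati hq h
  have h3 : (g : Matrix (Fin 2) (Fin 2) ℂ).det =
      ((Complex.normSq (g 0 0 + g 0 1 * cfst q) + Complex.normSq (csnd q * g 0 1) : ℝ) : ℂ) := by
    rw [det_fin_two]
    push_cast
    rw [← Complex.mul_conj, ← Complex.mul_conj]
    simp only [map_add, map_mul, starRingEnd_apply]
    linear_combination (g 0 1) * h1 - (g 0 0 + g 0 1 * cfst q) * h2
  refine ⟨_, lt_of_le_of_ne
    (add_nonneg (Complex.normSq_nonneg _) (Complex.normSq_nonneg _)) fun e => ?_, h3⟩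
  rw [← e, Complex.ofReal_zero] at h3
  have := (GeneralLinearGroup.det g).ne_zero
  exact this (by simpa using h3)

end ComplexMatrices

/-! ### Obstructions to systems of imprimitivity -/

/-- Two non-scalar elements `x`, `y` of a complex group which show that no line in `ℂ²` is
preserved by all squares of elements of the group. -/
def IsPrimitivePair (x y : GL (Fin 2) ℂ) : Prop :=
  (x : Matrix (Fin 2) (Fin 2) ℂ).trace ≠ 0 ∧ (y : Matrix (Fin 2) (Fin 2) ℂ).trace ≠ 0 ∧
    ((x : Matrix (Fin 2) (Fin 2) ℂ) * (y : Matrix (Fin 2) (Fin 2) ℂ) -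
      (y : Matrix (Fin 2) (Fin 2) ℂ) * (x : Matrix (Fin 2) (Fin 2) ℂ)).det ≠ 0

lemma IsPrimitivePair.conj {x y : GL (Fin 2) ℂ} (h : IsPrimitivePair x y) (P : GL (Fin 2) ℂ) :
    IsPrimitivePair (P⁻¹ * x * P) (P⁻¹ * y * P) := by
  have key : ∀ X : Matrix (Fin 2) (Fin 2) ℂ,
      (((P⁻¹ : GL (Fin 2) ℂ) : Matrix (Fin 2) (Fin 2) ℂ) * X * (P : Matrix (Fin 2) (Fin 2) ℂ)).trace =
        X.trace := fun X => Matrix.trace_units_conj' P X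
  refine ⟨?_, ?_, ?_⟩
  · rw [Units.val_mul, Units.val_mul, key]
    exact h.1
  · rw [Units.val_mul, Units.val_mul, key]
    exact h.2.1
  · have := Matrix.det_units_conj' P
      ((x : Matrix (Fin 2) (Fin 2) ℂ) * (y : Matrix (Fin 2) (Fin 2) ℂ) -
        (y : Matrix (Fin 2) (Fin 2) ℂ) * (x : Matrix (Fin 2) (Fin 2) ℂ))
    rw [mul_sub, sub_mul] at this
    convert h.2.2 using 1
    rw [← this]
    congr 1
    simp only [Units.val_mul]
    have e := Units.mul_inv P
    congr 1 <;> simp only [mul_assoc]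
    · rw [← mul_assoc (P : Matrix (Fin 2) (Fin 2) ℂ), e, one_mul]
    · rw [← mul_assoc (P : Matrix (Fin 2) (Fin 2) ℂ), e, one_mul]

/-- By Cayley–Hamilton `X² = (tr X) X - det X`, so an eigenvector of `X²` is one of `X` once the
trace is invertible. -/
lemma eigenvector_of_sq {X : Matrix (Fin 2) (Fin 2) ℂ} (ht : X.trace ≠ 0) {v : Fin 2 → ℂ} {μ : ℂ}
    (h : (X * X) *ᵥ v = μ • v) : ∃ ν : ℂ, X *ᵥ v = ν • v := by
  refine ⟨(μ + X.det) / X.trace, funext fun i => ?_⟩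
  have h0 := congrFun h 0
  have h1 := congrFun h 1
  rw [trace_fin_two] at *
  rw [det_fin_two]
  simp [Matrix.mulVec, dotProduct, Matrix.mul_apply, Fin.sum_univ_two] at h0 h1
  fin_cases i
  · simp [Matrix.mulVec, dotProduct, Fin.sum_univ_two]
    field_simp
    linear_combination h0
  · simp [Matrix.mulVec, dotProduct, Fin.sum_univ_two]
    field_simp
    linear_combination h1

/-- A system of imprimitivity of a primitive complex group contains the line of `(1, u + w j)`
for some `w ≠ 0`. -/
lemma IsSystemOfImprimitivity.exists_csnd_ne_zero {G : Subgroup (GL (Fin 2) ℂ)}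
    {𝒱 : Set (Submodule ℍ[ℝ]ᵐᵒᵖ (Fin 2 → ℍ[ℝ]))} (h : IsSystemOfImprimitivity (toQuat G) 𝒱)
    {x y : GL (Fin 2) ℂ} (hx : x ∈ G) (hy : y ∈ G) (hxy : IsPrimitivePair x y) :
    ∃ q W, csnd q ≠ 0 ∧ line ![1, q] ≠ W ∧ 𝒱 = {line ![1, q], W} := by
  obtain ⟨v, w, hv, hvw, rfl⟩ := h.exists_eq_pair
  rcases line_complex_or hv with ⟨z, hz, hvz⟩ | ⟨q, hq, hvq⟩
  · exfalso
    have hsq : ∀ g ∈ G, ∃ μ : ℂ,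
        ((g : Matrix (Fin 2) (Fin 2) ℂ) * (g : Matrix (Fin 2) (Fin 2) ℂ)) *ᵥ z = μ • z :=
        fun g hg => by
      have h1 : subspaceIso (quatHom (g * g)) (line v) = line v := by
        rw [map_mul, subspaceIso_mul]
        rcases fixes_or_swaps hvw (h.permutes _ (Subgroup.mem_map_of_mem quatHom hg)) with h1 | h1
        · rw [h1, h1]
        · rw [h1.1, h1.2]
      rw [hvz] at h1
      simpa using eigenvector_of_fixes_complex_line h1
    obtain ⟨μ, hμ⟩ := hsq x hx
    obtain ⟨ν, hν⟩ := hsq y hy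
    obtain ⟨μ', hμ'⟩ := eigenvector_of_sq hxy.1 hμ
    obtain ⟨ν', hν'⟩ := eigenvector_of_sq hxy.2.1 hν
    -- A common eigenvector of `x` and `y` lies in the kernel of their commutator.
    refine hxy.2.2 (Matrix.exists_mulVec_eq_zero_iff.1 ⟨z, hz, ?_⟩)
    rw [sub_mulVec, ← mulVec_mulVec, ← mulVec_mulVec, hμ', hν', mulVec_smul, mulVec_smul, hμ', hν',
      smul_comm, sub_self]
  · exact ⟨q, line w, hq, hvq ▸ hvw, by rw [hvq]⟩

/-- The square `g²` fixes the line of `(1, q)`, so `(det g)²` is a positive real number. -/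
lemma IsSystemOfImprimitivity.det_im_eq_zero {G : Subgroup (GL (Fin 2) ℂ)}
    {𝒱 : Set (Submodule ℍ[ℝ]ᵐᵒᵖ (Fin 2 → ℍ[ℝ]))} (h : IsSystemOfImprimitivity (toQuat G) 𝒱)
    {x y g : GL (Fin 2) ℂ} (hx : x ∈ G) (hy : y ∈ G) (hxy : IsPrimitivePair x y) (hg : g ∈ G) :
    (g : Matrix (Fin 2) (Fin 2) ℂ).det.im = 0 := by
  obtain ⟨q, W, hq, hW, rfl⟩ := h.exists_csnd_ne_zero hx hy hxy
  have h1 : subspaceIso (quatHom (g * g)) (line ![1, q]) = line ![1, q] := by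
    rw [map_mul, subspaceIso_mul]
    rcases fixes_or_swaps hW (h.permutes _ (Subgroup.mem_map_of_mem quatHom hg)) with h1 | h1
    · rw [h1, h1]
    · rw [h1.1, h1.2]
  obtain ⟨r, hr, hd⟩ := det_of_fixes hq h1
  rw [Units.val_mul, det_mul] at hd
  have hre := congrArg Complex.re hd
  have him := congrArg Complex.im hd
  simp only [Complex.mul_re, Complex.mul_im, Complex.ofReal_re, Complex.ofReal_im] at hre him
  by_contra hne
  have : (g : Matrix (Fin 2) (Fin 2) ℂ).det.re = 0 := by
    have h2 : (g : Matrix (Fin 2) (Fin 2) ℂ).det.im *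
        (g : Matrix (Fin 2) (Fin 2) ℂ).det.re = 0 := by linarith
    exact (mul_eq_zero.1 h2).resolve_left hne
  rw [this] at hre
  nlinarith [sq_nonneg (g : Matrix (Fin 2) (Fin 2) ℂ).det.im]

/-! ### Entries of the generators -/

lemma τ_sq : τ ^ 2 = τ + 1 := by
  have := Real.sq_sqrt (show (0 : ℝ) ≤ 5 by norm_num)
  rw [τ]
  linear_combination this / 4

lemma one_lt_τ : 1 < τ := by
  have : (1 : ℝ) < √5 := by rw [Real.lt_sqrt] <;> norm_num
  rw [τ]
  linarith

lemma τ_lt_two : τ < 2 := by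
  have : √5 < 3 := by rw [Real.sqrt_lt'] <;> norm_num
  rw [τ]
  linarith

section Entries

/-- The scalar factor of `Z`. -/
def zScalar : ℂ := ⟨(1 + √3) / 4, (√3 - 1) / 4⟩

/-- The scalar factor of `M`. -/
def mScalar : ℂ := ⟨-τ / 4, √(1 - τ ^ 2 / 4) / 2⟩

lemma zScalar_ne_zero : zScalar ≠ 0 := fun h => by
  have := congrArg Complex.re h
  have h3 := Real.sqrt_nonneg 3
  simp only [Complex.zero_re, zScalar] at this
  linarith

lemma mScalar_ne_zero : mScalar ≠ 0 := fun h => by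
  have := congrArg Complex.re h
  simp only [Complex.zero_re, mScalar] at this
  linarith [one_lt_τ]

lemma coe_F : (F : Matrix (Fin 2) (Fin 2) ℂ) = ((1 / √2 : ℝ) : ℂ) • !![1, 1; 1, -1] := rfl

lemma coe_R : (R : Matrix (Fin 2) (Fin 2) ℂ) = !![1, 0; 0, -Complex.I] := rfl

lemma coe_A : (A : Matrix (Fin 2) (Fin 2) ℂ) = !![1, 0; 0, -1] := rfl

lemma coe_Z : (Z : Matrix (Fin 2) (Fin 2) ℂ) = zScalar • !![1, 1; -Complex.I, Complex.I] := rfl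

lemma coe_M : (M : Matrix (Fin 2) (Fin 2) ℂ) = mScalar •
    !![-τ + Complex.I, (σ : ℂ); -σ, -τ - Complex.I] := rfl

/-- Checking `X h = h g` avoids computing an inverse matrix. -/
lemma coe_cj_eq {g h : GL (Fin 2) ℂ} {X : Matrix (Fin 2) (Fin 2) ℂ}
    (e : X * (h : Matrix (Fin 2) (Fin 2) ℂ) =
      (h : Matrix (Fin 2) (Fin 2) ℂ) * (g : Matrix (Fin 2) (Fin 2) ℂ)) :
    (cj g h : Matrix (Fin 2) (Fin 2) ℂ) = X := by
  rw [cj, Units.val_mul, Units.val_mul, ← e, mul_assoc, Units.mul_inv, mul_one]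

lemma coe_cj_Z_A : (cj Z A : Matrix (Fin 2) (Fin 2) ℂ) =
    zScalar • !![1, -1; Complex.I, Complex.I] := by
  refine coe_cj_eq ?_
  rw [coe_Z, coe_A, Matrix.smul_mul, Matrix.mul_smul]
  congr 1
  simp

lemma coe_cj_Z_F : (cj Z F : Matrix (Fin 2) (Fin 2) ℂ) =
    zScalar • !![1, -Complex.I; 1, Complex.I] := by
  refine coe_cj_eq ?_
  rw [coe_Z, coe_F, smul_mul_smul_comm, smul_mul_smul_comm, mul_comm zScalar]
  congr 1
  simp

lemma coe_cj_R_F : (cj R F : Matrix (Fin 2) (Fin 2) ℂ) =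
    !![(1 - Complex.I) / 2, (1 + Complex.I) / 2; (1 + Complex.I) / 2, (1 - Complex.I) / 2] := by
  refine coe_cj_eq ?_
  rw [coe_R, coe_F, Matrix.smul_mul, Matrix.mul_smul]
  congr 1
  ext i j
  fin_cases i <;> fin_cases j <;> simp <;> ring

lemma coe_cj_M_A : (cj M A : Matrix (Fin 2) (Fin 2) ℂ) = mScalar •
    !![-τ + Complex.I, -(σ : ℂ); σ, -τ - Complex.I] := by
  refine coe_cj_eq ?_
  rw [coe_M, coe_A, Matrix.smul_mul, Matrix.mul_smul]
  congr 1
  ext i j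
  fin_cases i <;> fin_cases j <;> simp

lemma coe_cj_Z_M : (cj Z M : Matrix (Fin 2) (Fin 2) ℂ) = zScalar •
    !![(τ + 1 + (1 - τ) * Complex.I) / 2, (τ - 1) * (1 - Complex.I) / 2;
      (τ - 1) * (1 - Complex.I) / 2, (1 - τ + (1 + τ) * Complex.I) / 2] := by
  refine coe_cj_eq ?_
  rw [coe_M, coe_Z, smul_mul_smul_comm, smul_mul_smul_comm, mul_comm zScalar]
  congr 1
  have h := τ_sq
  ext i j
  fin_cases i <;> fin_cases j <;> apply Complex.ext <;>
    simp [σ]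
  all_goals linarith

end Entries

/-! ### The sixteen groups without a system -/

section PrimitivePairs

lemma IsPrimitivePair.of_smul {x y : GL (Fin 2) ℂ} {s t : ℂ} {X Y : Matrix (Fin 2) (Fin 2) ℂ}
    (hs : s ≠ 0) (ht : t ≠ 0) (hx : (x : Matrix (Fin 2) (Fin 2) ℂ) = s • X)
    (hy : (y : Matrix (Fin 2) (Fin 2) ℂ) = t • Y) (hX : X.trace ≠ 0) (hY : Y.trace ≠ 0)
    (h : (X * Y - Y * X).det ≠ 0) : IsPrimitivePair x y := by
  refine ⟨?_, ?_, ?_⟩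
  · rw [hx, trace_smul]
    exact smul_ne_zero hs hX
  · rw [hy, trace_smul]
    exact smul_ne_zero ht hY
  · rw [hx, hy]
    have : s • X * t • Y - t • Y * s • X = (s * t) • (X * Y - Y * X) := by
      simp only [Matrix.smul_mul, Matrix.mul_smul, smul_smul, smul_sub, mul_comm]
    rw [this, det_smul]
    exact mul_ne_zero (pow_ne_zero _ (mul_ne_zero hs ht)) h

lemma ne_zero_of_re {z : ℂ} (h : z.re ≠ 0) : z ≠ 0 := fun e => h (by rw [e, Complex.zero_re])

lemma isPrimitivePair_Z_A : IsPrimitivePair Z (cj Z A) := by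
  refine .of_smul zScalar_ne_zero zScalar_ne_zero coe_Z coe_cj_Z_A ?_ ?_ ?_
  all_goals
    refine ne_zero_of_re ?_
    simp [trace_fin_two, det_fin_two]
    try norm_num

lemma isPrimitivePair_Z_F : IsPrimitivePair Z (cj Z F) := by
  refine .of_smul zScalar_ne_zero zScalar_ne_zero coe_Z coe_cj_Z_F ?_ ?_ ?_
  all_goals
    refine ne_zero_of_re ?_
    simp [trace_fin_two, det_fin_two]
    try norm_num

lemma isPrimitivePair_R_F : IsPrimitivePair R (cj R F) := by
  refine .of_smul one_ne_zero one_ne_zero (by rw [one_smul, coe_R])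
    (by rw [one_smul, coe_cj_R_F]) ?_ ?_ ?_
  all_goals
    refine ne_zero_of_re ?_
    simp [trace_fin_two, det_fin_two]
    try norm_num

lemma isPrimitivePair_R_Z : IsPrimitivePair R Z := by
  refine .of_smul one_ne_zero zScalar_ne_zero (by rw [one_smul, coe_R]) coe_Z ?_ ?_ ?_
  · refine ne_zero_of_re ?_
    simp [trace_fin_two]
  · refine ne_zero_of_re ?_
    simp [trace_fin_two]
  · refine ne_zero_of_re ?_
    simp [det_fin_two]

lemma isPrimitivePair_M_A : IsPrimitivePair M (cj M A) := by
  have h1 := τ_sq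
  have h2 := one_lt_τ
  refine .of_smul mScalar_ne_zero mScalar_ne_zero coe_M coe_cj_M_A ?_ ?_ ?_ <;>
    refine ne_zero_of_re ?_ <;> simp [trace_fin_two, det_fin_two, σ] 
  · linarith
  · linarith
  · intro e
    nlinarith

lemma isPrimitivePair_Z_M : IsPrimitivePair Z M := by
  have h1 := τ_sq
  have h2 := one_lt_τ
  refine .of_smul zScalar_ne_zero mScalar_ne_zero coe_Z coe_M ?_ ?_ ?_
  · refine ne_zero_of_re ?_
    simp [trace_fin_two]
  · refine ne_zero_of_re ?_
    simp [trace_fin_two, σ]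
    linarith
  · intro e
    have := congrArg Complex.im e
    simp [det_fin_two, σ] at this
    nlinarith

lemma isPrimitivePair_Z_cj_M : IsPrimitivePair Z (cj Z M) := by
  have h1 := τ_sq
  have h2 := one_lt_τ
  refine .of_smul zScalar_ne_zero zScalar_ne_zero coe_Z coe_cj_Z_M ?_ ?_ ?_ <;>
    refine ne_zero_of_re ?_ <;> simp [trace_fin_two, det_fin_two]
  · ring_nf
    norm_num
  · intro e
    nlinarith

end PrimitivePairs

lemma det_Z_im : (Z : Matrix (Fin 2) (Fin 2) ℂ).det.im ≠ 0 := by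
  have h := Real.sq_sqrt (show (0 : ℝ) ≤ 3 by norm_num)
  have h0 := Real.sqrt_pos.2 (show (0 : ℝ) < 3 by norm_num)
  rw [coe_Z, det_smul, det_fin_two_of, zScalar]
  simp [pow_two]
  nlinarith

lemma det_R_im : (R : Matrix (Fin 2) (Fin 2) ℂ).det.im ≠ 0 := by
  rw [coe_R, det_fin_two_of]
  simp

lemma det_M_im : (M : Matrix (Fin 2) (Fin 2) ℂ).det.im ≠ 0 := by
  have h0 : 0 < √(1 - τ ^ 2 / 4) := Real.sqrt_pos.2 (by nlinarith [τ_lt_two, one_lt_τ])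
  have h1 : ((-τ : ℂ) + Complex.I) * (-τ - Complex.I) - σ * -σ = 4 := by
    have h2 : (τ : ℂ) ^ 2 = τ + 1 := by exact_mod_cast τ_sq
    rw [σ]
    push_cast
    linear_combination 2 * h2 - Complex.I_sq
  rw [coe_M, det_smul, det_fin_two_of, h1, mScalar]
  simp only [Fintype.card_fin, pow_two, Complex.mul_im, Complex.mul_re, Complex.re_ofNat,
    Complex.im_ofNat] at h0 ⊢
  nlinarith [mul_pos h0 (zero_lt_one.trans one_lt_τ)]

lemma cj_mem {G : Subgroup (GL (Fin 2) ℂ)} {g h : GL (Fin 2) ℂ} (hg : g ∈ G) (hh : h ∈ G) :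
    cj g h ∈ G :=
  G.mul_mem (G.mul_mem hh hg) (G.inv_mem hh)

/-- The obstruction to a quaternionic system of imprimitivity. -/
def HasObstruction (G : Subgroup (GL (Fin 2) ℂ)) : Prop :=
  ∃ x ∈ G, ∃ y ∈ G, ∃ g ∈ G, IsPrimitivePair x y ∧ (g : Matrix (Fin 2) (Fin 2) ℂ).det.im ≠ 0

/-- The Shephard-Todd groups other than `G₁₂`, `G₁₃` and `G₂₂` are primitive and contain elements
whose determinant is not real. -/
lemma hasObstruction_shephardTodd {n : ℕ} (h4 : 4 ≤ n) (h22 : n ≤ 22)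
    (hn : ¬(n = 12 ∨ n = 13 ∨ n = 22)) :
    HasObstruction (shephardTodd n) := by
  have mem : ∀ {k g}, g ∈ shephardToddGens k → g ∈ shephardTodd k :=
    fun h => Subgroup.subset_closure h
  have hZA : Z ∈ shephardTodd n → cj Z A ∈ shephardTodd n →
      HasObstruction (shephardTodd n) := fun hZ hZA =>
    ⟨Z, hZ, cj Z A, hZA, Z, hZ, isPrimitivePair_Z_A, det_Z_im⟩
  have hZF : Z ∈ shephardTodd n → cj Z F ∈ shephardTodd n →
      HasObstruction (shephardTodd n) := fun hZ hZF =>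
    ⟨Z, hZ, cj Z F, hZF, Z, hZ, isPrimitivePair_Z_F, det_Z_im⟩
  have hRF : R ∈ shephardTodd n → cj R F ∈ shephardTodd n →
      HasObstruction (shephardTodd n) := fun hR hRF =>
    ⟨R, hR, cj R F, hRF, R, hR, isPrimitivePair_R_F, det_R_im⟩
  have hMA : M ∈ shephardTodd n → cj M A ∈ shephardTodd n →
      HasObstruction (shephardTodd n) := fun hM hMA =>
    ⟨M, hM, cj M A, hMA, M, hM, isPrimitivePair_M_A, det_M_im⟩
  have hRZ : R ∈ shephardTodd n → Z ∈ shephardTodd n →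
      HasObstruction (shephardTodd n) := fun hR hZ =>
    ⟨R, hR, Z, hZ, Z, hZ, isPrimitivePair_R_Z, det_Z_im⟩
  have hZM : Z ∈ shephardTodd n → M ∈ shephardTodd n →
      HasObstruction (shephardTodd n) := fun hZ hM =>
    ⟨Z, hZ, M, hM, Z, hZ, isPrimitivePair_Z_M, det_Z_im⟩
  have hZcM : Z ∈ shephardTodd n → cj Z M ∈ shephardTodd n →
      HasObstruction (shephardTodd n) := fun hZ hZM =>
    ⟨Z, hZ, cj Z M, hZM, Z, hZ, isPrimitivePair_Z_cj_M, det_Z_im⟩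
  interval_cases n
  · exact hZA (mem (by simp [shephardToddGens])) (mem (by simp [shephardToddGens]))
  · exact hZF (mem (by simp [shephardToddGens])) (mem (by simp [shephardToddGens]))
  · exact hZA (mem (by simp [shephardToddGens]))
      (cj_mem (mem (by simp [shephardToddGens])) (mem (by simp [shephardToddGens])))
  · exact hZF (mem (by simp [shephardToddGens])) (mem (by simp [shephardToddGens]))
  · exact hRF (mem (by simp [shephardToddGens])) (mem (by simp [shephardToddGens]))
  · exact hRF (mem (by simp [shephardToddGens]))
      (cj_mem (mem (by simp [shephardToddGens])) (mem (by simp [shephardToddGens])))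
  · exact hRZ (mem (by simp [shephardToddGens])) (mem (by simp [shephardToddGens]))
  · exact hRZ (mem (by simp [shephardToddGens])) (mem (by simp [shephardToddGens]))
  · simp at hn
  · simp at hn
  · exact hZF (mem (by simp [shephardToddGens]))
      (cj_mem (mem (by simp [shephardToddGens])) (mem (by simp [shephardToddGens])))
  · exact hZF (mem (by simp [shephardToddGens]))
      (cj_mem (mem (by simp [shephardToddGens])) (mem (by simp [shephardToddGens])))
  · exact hMA (mem (by simp [shephardToddGens])) (mem (by simp [shephardToddGens]))
  · exact hMA (mem (by simp [shephardToddGens]))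
      (cj_mem (mem (by simp [shephardToddGens])) (mem (by simp [shephardToddGens])))
  · exact hZM (mem (by simp [shephardToddGens])) (mem (by simp [shephardToddGens]))
  · exact hZM (mem (by simp [shephardToddGens])) (mem (by simp [shephardToddGens]))
  · exact hZcM (mem (by simp [shephardToddGens])) (mem (by simp [shephardToddGens]))
  · exact hZA (mem (by simp [shephardToddGens]))
      (cj_mem (mem (by simp [shephardToddGens])) (mem (by simp [shephardToddGens])))
  · simp at hn

lemma not_isSystemOfImprimitivity {n : ℕ} (h4 : 4 ≤ n) (h22 : n ≤ 22)
    (hn : ¬(n = 12 ∨ n = 13 ∨ n = 22)) (P : GL (Fin 2) ℂ)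
    (𝒱 : Set (Submodule ℍ[ℝ]ᵐᵒᵖ (Fin 2 → ℍ[ℝ]))) :
    ¬ IsSystemOfImprimitivity (toQuat (changeBasis P (shephardTodd n))) 𝒱 := fun h => by
  obtain ⟨x, hx, y, hy, g, hg, hxy, hdet⟩ := hasObstruction_shephardTodd h4 h22 hn
  have mem : ∀ {k}, k ∈ shephardTodd n → P⁻¹ * k * P ∈ changeBasis P (shephardTodd n) :=
    fun hk => ⟨_, hk, by simp⟩
  have := h.det_im_eq_zero (mem hx) (mem hy) (hxy.conj P) (mem hg)
  rw [Units.val_mul, Units.val_mul, det_units_conj'] at this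
  exact hdet this

/-! ### Hermitian reflections of order two -/

section Hermitian

/-- The traceless Hermitian matrix with the given coordinates. -/
def herm (a x y : ℝ) : Matrix (Fin 2) (Fin 2) ℂ := !![⟨a, 0⟩, ⟨x, y⟩; ⟨x, -y⟩, ⟨-a, 0⟩]

/-- A Hermitian reflection of order two. -/
def IsHermReflection (g : GL (Fin 2) ℂ) (a x y : ℝ) : Prop :=
  a ^ 2 + x ^ 2 + y ^ 2 = 1 ∧ (g : Matrix (Fin 2) (Fin 2) ℂ) = herm a x y

variable {g h : GL (Fin 2) ℂ} {a x y a' x' y' : ℝ}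

lemma herm_mul_herm : herm a x y * herm a' x' y' =
    !![⟨a * a' + x * x' + y * y', y * x' - x * y'⟩, ⟨a * x' - x * a', a * y' - y * a'⟩;
      ⟨x * a' - a * x', a * y' - y * a'⟩, ⟨a * a' + x * x' + y * y', x * y' - y * x'⟩] := by
  ext i j
  fin_cases i <;> fin_cases j <;> apply Complex.ext <;> simp [herm] <;> ring

lemma herm_mul_herm_mul_herm : herm a x y * herm a' x' y' * herm a x y =
    herm (2 * (a * a' + x * x' + y * y') * a - (a ^ 2 + x ^ 2 + y ^ 2) * a')
      (2 * (a * a' + x * x' + y * y') * x - (a ^ 2 + x ^ 2 + y ^ 2) * x')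
      (2 * (a * a' + x * x' + y * y') * y - (a ^ 2 + x ^ 2 + y ^ 2) * y') := by
  rw [herm_mul_herm]
  ext i j
  fin_cases i <;> fin_cases j <;> apply Complex.ext <;> simp [herm] <;> ring

namespace IsHermReflection

lemma mul_self (hg : IsHermReflection g a x y) : g * g = 1 := by
  apply Units.ext
  rw [Units.val_mul, hg.2, herm_mul_herm]
  have := hg.1
  ext i j
  fin_cases i <;> fin_cases j <;> apply Complex.ext <;> simp <;> linarith

/-- The conjugate of a reflection by another one is the reflection in the reflected root. -/
lemma conj (hg : IsHermReflection g a x y) (hh : IsHermReflection h a' x' y') :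
    IsHermReflection (g * h * g) (2 * (a * a' + x * x' + y * y') * a - a')
      (2 * (a * a' + x * x' + y * y') * x - x') (2 * (a * a' + x * x' + y * y') * y - y') := by
  refine ⟨by linear_combination 4 * (a * a' + x * x' + y * y') ^ 2 * hg.1 + hh.1, ?_⟩
  rw [Units.val_mul, Units.val_mul, hg.2, hh.2, herm_mul_herm_mul_herm, hg.1, one_mul, one_mul,
    one_mul]

lemma eq (hg : IsHermReflection g a x y) (hh : IsHermReflection h a' x' y') (ha : a = a')
    (hx : x = x') (hy : y = y') : g = h :=
  Units.ext (by rw [hg.2, hh.2, ha, hx, hy])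

lemma det (hg : IsHermReflection g a x y) : (g : Matrix (Fin 2) (Fin 2) ℂ).det = -1 := by
  have := hg.1
  rw [hg.2, herm, det_fin_two_of]
  apply Complex.ext
  · simp
    linarith
  · simp
    ring

end IsHermReflection

end Hermitian

/-- The quaternion with the given coordinates. -/
def quat (a b c d : ℝ) : ℍ[ℝ] := ⟨a, b, c, d⟩

@[simp] lemma quat_re (a b c d : ℝ) : (quat a b c d).re = a := rfl

@[simp] lemma quat_imI (a b c d : ℝ) : (quat a b c d).imI = b := rfl

@[simp] lemma quat_imJ (a b c d : ℝ) : (quat a b c d).imJ = c := rfl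

@[simp] lemma quat_imK (a b c d : ℝ) : (quat a b c d).imK = d := rfl

/-! ### The lines of `(1, z j)` and `(z j, 1)` -/

section MulJ

variable {z : ℂ}

lemma mulJ_eq : mulJ z = quat 0 0 z.re z.im := by
  have : mulJ z = (z : ℍ[ℝ]) * quat 0 0 1 0 := rfl
  rw [this]
  ext <;> simp

lemma star_mulJ : star (mulJ z) = -mulJ z := by
  ext <;> simp [mulJ_eq]

lemma mulJ_mul_coe (b : ℂ) : mulJ z * (b : ℍ[ℝ]) = ((star b : ℂ) : ℍ[ℝ]) * mulJ z := by
  ext <;> simp [mulJ_eq] <;> ring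

lemma mulJ_mul_mulJ (hz : ‖z‖ = 1) : mulJ z * mulJ z = -1 := by
  have : z.re ^ 2 + z.im ^ 2 = 1 := by
    have := Complex.normSq_eq_norm_sq z
    rw [hz, Complex.normSq_apply] at this
    linarith
  ext <;> simp [mulJ_eq] <;> linarith

lemma mulJ_csnd {q : ℍ[ℝ]} (h : cfst q = 0) : mulJ (csnd q) = q := by
  have h1 := congrArg Complex.re h
  have h2 := congrArg Complex.im h
  simp only [cfst, Complex.zero_re, Complex.zero_im] at h1 h2
  ext <;> simp [mulJ_eq, csnd, h1, h2]

lemma IsHermReflection.map_line {g : GL (Fin 2) ℂ} {a x y : ℝ} (hg : IsHermReflection g a x y)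
    (hz : ‖z‖ = 1) :
    subspaceIso (quatHom g) (line ![1, mulJ z]) = line ![mulJ z, 1] := by
  rw [subspaceIso_line]
  -- With `β = x + y i` and `q = z j`, the image of `(1, q)` is `(a + β q, β̄ - a q)`. As `q β̄ = β
  -- q` and `q² = -1`, it equals `(q, 1)(β̄ - a q)`.
  refine line_eq_of_mem (fun e => ?_) (mem_line_iff.2
    ⟨((⟨x, -y⟩ : ℂ) : ℍ[ℝ]) - ((⟨a, 0⟩ : ℂ) : ℍ[ℝ]) * mulJ z, ?_⟩)
  · have h1 : ((g⁻¹ : GL (Fin 2) ℂ) : Matrix (Fin 2) (Fin 2) ℂ) * g = 1 := Units.inv_mul g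
    have h2 := congrArg (((quatHom g)⁻¹ : GL (Fin 2) ℍ[ℝ]) : Matrix (Fin 2) (Fin 2) ℍ[ℝ]).mulVec e
    rw [mulVec_mulVec, Units.inv_mul, one_mulVec, mulVec_zero] at h2
    simpa using congrFun h2 0
  · rw [coe_quatHom, hg.2]
    have h1 := mulJ_mul_mulJ hz
    have hx : mulJ z * ((⟨x, -y⟩ : ℂ) : ℍ[ℝ]) = ((⟨x, y⟩ : ℂ) : ℍ[ℝ]) * mulJ z := by
      rw [mulJ_mul_coe]
      congr 3
      apply Complex.ext <;> simp
    have ha : mulJ z * ((⟨a, 0⟩ : ℂ) : ℍ[ℝ]) = ((⟨a, 0⟩ : ℂ) : ℍ[ℝ]) * mulJ z := by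
      rw [mulJ_mul_coe]
      congr 3
      apply Complex.ext <;> simp
    have hna : ((⟨-a, 0⟩ : ℂ) : ℍ[ℝ]) = -((⟨a, 0⟩ : ℂ) : ℍ[ℝ]) := by
      ext <;> simp
    ext1 i
    fin_cases i
    · simp only [herm, Matrix.mulVec, dotProduct, Fin.sum_univ_two, Fin.zero_eta,
        Matrix.of_apply, Matrix.cons_val_zero, Matrix.cons_val_one, mul_one]
      rw [mul_sub, hx, ← mul_assoc, ha, mul_assoc, h1]
      noncomm_ring
    · simp only [herm, Matrix.mulVec, dotProduct, Fin.sum_univ_two, Fin.mk_one,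
        Matrix.of_apply, Matrix.cons_val_zero, Matrix.cons_val_one, one_mul, mul_one, hna]
      noncomm_ring

lemma isCompl_lines (hz : ‖z‖ = 1) : IsCompl (line ![1, mulJ z]) (line ![mulJ z, 1]) := by
  have h1 := mulJ_mul_mulJ hz
  have h2 : ∀ c, mulJ z * (mulJ z * c) = -c := fun c => by rw [← mul_assoc, h1, neg_one_mul]
  constructor
  · rw [Submodule.disjoint_def]
    intro v hv hw
    obtain ⟨c, rfl⟩ := mem_line_iff.1 hv
    obtain ⟨e, he⟩ := mem_line_iff.1 hw
    have e0 := congrFun he 0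
    have e1 := congrFun he 1
    simp only [Matrix.cons_val_zero, Matrix.cons_val_one, one_mul] at e0 e1
    rw [e1, h2] at e0
    have hc : c = 0 := by
      ext <;> [have := congrArg (·.re) e0; have := congrArg (·.imI) e0;
        have := congrArg (·.imJ) e0; have := congrArg (·.imK) e0] <;> simp at this <;> simp <;>
        linarith
    ext1 i
    simp [hc]
  · rw [codisjoint_iff, Submodule.eq_top_iff']
    intro v
    -- Since `q² = -1`, these coefficients solve `c + q e = v₀`, `q c + e = v₁`.
    refine Submodule.mem_sup.2 ⟨_, mem_line_iff.2 ⟨(1 / 2 : ℝ) • (v 0 - mulJ z * v 1), rfl⟩, _,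
      mem_line_iff.2 ⟨(1 / 2 : ℝ) • (v 1 - mulJ z * v 0), rfl⟩, ?_⟩
    ext1 i
    fin_cases i <;> simp [mul_sub, -mul_eq_mul_left_iff, -one_div, h2] <;> module

lemma line_ne_line (hz : ‖z‖ = 1) : line ![1, mulJ z] ≠ line ![mulJ z, 1] := fun e => by
  have h := (isCompl_lines hz).disjoint
  rw [e, disjoint_self, line, Submodule.span_singleton_eq_bot] at h
  simpa using congrFun h 1

lemma orthogonalSystem_mulJ :
    orthogonalSystem (mulJ z) = {line ![1, mulJ z], line ![mulJ z, 1]} := by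
  rw [orthogonalSystem, star_mulJ, neg_neg]

end MulJ

/-! ### Classification of systems for groups of Hermitian reflections -/

section HermitianGroups

/-- Every element of `S` is a Hermitian reflection of order two. -/
def IsHermReflectionSet (S : Set (GL (Fin 2) ℂ)) : Prop :=
  ∀ g ∈ S, ∃ a x y, IsHermReflection g a x y

variable {S : Set (GL (Fin 2) ℂ)}

lemma IsHermReflectionSet.isSystemOfImprimitivity (hS : IsHermReflectionSet S) {z : ℂ}
    (hz : ‖z‖ = 1) :
    IsSystemOfImprimitivity (toQuat (Subgroup.closure S)) (orthogonalSystem (mulJ z)) := by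
  rw [orthogonalSystem_mulJ]
  have hne := line_ne_line hz
  have hc := isCompl_lines hz
  refine ⟨(Set.encard_pair hne).ge, ?_, (sSupIndep_pair hne).2 hc.disjoint, ?_, ?_⟩
  · rintro V (rfl | rfl) h
    · rw [line, Submodule.span_singleton_eq_bot] at h
      simpa using congrFun h 0
    · rw [line, Submodule.span_singleton_eq_bot] at h
      simpa using congrFun h 1
  · rw [sSup_pair, hc.sup_eq_top]
  · rintro _ ⟨g, hg, rfl⟩
    change subspaceIso (quatHom g) '' _ = _
    induction hg using Subgroup.closure_induction with
    | mem g hg =>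
      obtain ⟨a, x, y, h⟩ := hS g hg
      have h1 := h.map_line hz
      have h2 : subspaceIso (quatHom g) (line ![mulJ z, 1]) = line ![1, mulJ z] := by
        rw [← h1, ← subspaceIso_mul, ← map_mul, h.mul_self, map_one, subspaceIso_one]
      rw [Set.image_pair, h1, h2, Set.pair_comm]
    | one =>
      rw [map_one]
      simp [subspaceIso_one]
    | mul g h _ _ hg hh =>
      rw [map_mul]
      conv_rhs => rw [← hg, ← hh, Set.image_image]
      simp only [subspaceIso_mul]
    | inv g _ hg =>
      conv_lhs => rw [← hg, Set.image_image]
      simp only [← subspaceIso_mul, ← map_mul, inv_mul_cancel, map_one, subspaceIso_one,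
        Set.image_id']

/-- The upper right entry of the product of two Hermitian reflections. -/
def offDiag (s t : GL (Fin 2) ℂ) : ℂ := (s * t : GL (Fin 2) ℂ) 0 1

/-- The primitive pair provides a line of `(1, u + w j)` with `w ≠ 0`; the products `s t` and `s t'`
fix it, and their Riccati equations determine `u` and `|w|`. -/
lemma IsHermReflectionSet.isSystemOfImprimitivity_iff (hS : IsHermReflectionSet S)
    {p p' s t t' : GL (Fin 2) ℂ} (hp : p ∈ Subgroup.closure S) (hp' : p' ∈ Subgroup.closure S)
    (hpp : IsPrimitivePair p p') (hs : s ∈ S) (ht : t ∈ S) (ht' : t' ∈ S)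
    (hst : (offDiag s t).re * (offDiag s t').im ≠ (offDiag s t).im * (offDiag s t').re)
    (𝒱 : Set (Submodule ℍ[ℝ]ᵐᵒᵖ (Fin 2 → ℍ[ℝ]))) :
    IsSystemOfImprimitivity (toQuat (Subgroup.closure S)) 𝒱 ↔
      ∃ z : ℂ, ‖z‖ = 1 ∧ 𝒱 = orthogonalSystem (mulJ z) := by
  refine ⟨fun h => ?_, ?_⟩
  swap
  · rintro ⟨z, hz, rfl⟩
    exact hS.isSystemOfImprimitivity hz
  obtain ⟨q, W, hq, hW, rfl⟩ := h.exists_csnd_ne_zero hp hp' hpp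
  -- A reflection here has determinant `-1`, whereas fixing the line would require a positive
  -- determinant.
  have swaps : ∀ g ∈ S, subspaceIso (quatHom g) (line ![1, q]) = W ∧
      subspaceIso (quatHom g) W = line ![1, q] := fun g hg => by
    refine (fixes_or_swaps hW (h.permutes _ (Subgroup.mem_map_of_mem quatHom
      (Subgroup.subset_closure hg)))).resolve_left fun e => ?_
    obtain ⟨r, hr, hd⟩ := det_of_fixes hq e
    obtain ⟨a, x, y, hg⟩ := hS g hg
    rw [hg.det] at hd
    have := congrArg Complex.re hd
    simp at this
    linarith
  have key : ∀ s ∈ S, ∀ t ∈ S, cfst q * (s * t : GL (Fin 2) ℂ) 0 0 + offDiag s t * cfst q ^ 2 -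
      csnd q * star (csnd q) * star (offDiag s t) =
        -star (offDiag s t) + star ((s * t : GL (Fin 2) ℂ) 0 0) * cfst q ∧
      (offDiag s t).re * (cfst q).re - (offDiag s t).im * (cfst q).im = 0 := fun s hs t ht => by
    have h1 : subspaceIso (quatHom (s * t)) (line ![1, q]) = line ![1, q] := by
      rw [map_mul, subspaceIso_mul, (swaps t ht).1, (swaps s hs).2]
    obtain ⟨a, x, y, h2⟩ := hS s hs
    obtain ⟨a', x', y', h3⟩ := hS t ht
    have h4 := congrArg₂ (· * ·) h2.2 h3.2
    simp only [herm_mul_herm, ← Units.val_mul] at h4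
    obtain ⟨e1, e2⟩ := riccati hq h1
    have h10 : (s * t : GL (Fin 2) ℂ) 1 0 = -star (offDiag s t) := by
      rw [offDiag, h4]
      apply Complex.ext <;> simp
    have h11 : (s * t : GL (Fin 2) ℂ) 1 1 = star ((s * t : GL (Fin 2) ℂ) 0 0) := by
      rw [h4]
      apply Complex.ext <;> simp
    rw [h10, h11] at e1
    refine ⟨e1, ?_⟩
    rw [h11] at e2
    have aux : ∀ α β u : ℂ, star α + β * u + star β * star u = star α →
        β.re * u.re - β.im * u.im = 0 := fun α β u e => by
      have := congrArg Complex.re e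
      simp at this
      linarith
    exact aux _ _ _ e2
  have k1 := key s hs t ht
  have k2 := key s hs t' ht'
  -- The equations `Re (β u) = 0` for the two off-diagonal entries `β` are independent over `ℝ` by
  -- `hst`.
  have hu : cfst q = 0 := by
    refine Complex.ext ?_ ?_
    · refine (mul_eq_zero.1 (?_ : ((offDiag s t).re * (offDiag s t').im -
        (offDiag s t).im * (offDiag s t').re) * (cfst q).re = 0)).resolve_left (sub_ne_zero.2 hst)
      linear_combination (offDiag s t').im * k1.2 - (offDiag s t).im * k2.2
    · refine (mul_eq_zero.1 (?_ : ((offDiag s t).re * (offDiag s t').im -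
        (offDiag s t).im * (offDiag s t').re) * (cfst q).im = 0)).resolve_left (sub_ne_zero.2 hst)
      linear_combination (offDiag s t').re * k1.2 - (offDiag s t).re * k2.2
  -- With `u = 0` the first Riccati component reads `w w̄ β̄ = β̄`, and `β ≠ 0` by `hst`.
  have hw : ‖csnd q‖ = 1 := by
    have hb : star (offDiag s t) ≠ 0 := fun e => hst (by simp [star_eq_zero.1 e])
    have h1 := k1.1
    rw [hu] at h1
    have h2 : csnd q * star (csnd q) = 1 := mul_right_cancel₀ hb (by linear_combination -h1)
    have h3 : (Complex.normSq (csnd q) : ℂ) = 1 := by rw [← Complex.mul_conj]; exact h2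
    rw [Complex.normSq_eq_norm_sq] at h3
    have h4 : ‖csnd q‖ ^ 2 = 1 := by exact_mod_cast h3
    exact (pow_eq_one_iff_of_nonneg (norm_nonneg _) two_ne_zero).1 h4
  refine ⟨csnd q, hw, ?_⟩
  obtain ⟨a, x, y, h2⟩ := hS s hs
  have h3 := h2.map_line hw
  rw [mulJ_csnd hu] at h3
  rw [orthogonalSystem_mulJ, mulJ_csnd hu, ← h3, (swaps s hs).1]

end HermitianGroups

/-! ### Roots of the generators of `G₁₂`, `G₁₃`, `G₂₂` -/

lemma inv_sqrt_two_sq : (1 / √2) ^ 2 = 1 / 2 := by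
  rw [div_pow, one_pow, Real.sq_sqrt (by norm_num)]

/-- Conjugation by a scalar multiple of `X`. -/
lemma IsHermReflection.cj_of_smul {g h : GL (Fin 2) ℂ} {a x y a' x' y' : ℝ} {s : ℂ}
    {X : Matrix (Fin 2) (Fin 2) ℂ} (hg : IsHermReflection g a x y)
    (hX : (h : Matrix (Fin 2) (Fin 2) ℂ) = s • X) (hn : a' ^ 2 + x' ^ 2 + y' ^ 2 = 1)
    (e : herm a' x' y' * X = X * herm a x y) : IsHermReflection (cj g h) a' x' y' :=
  ⟨hn, coe_cj_eq (by rw [hX, hg.2, Matrix.mul_smul, Matrix.smul_mul, e])⟩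

lemma isHermReflection_F : IsHermReflection F (1 / √2) (1 / √2) 0 := by
  refine ⟨by rw [inv_sqrt_two_sq]; norm_num, ?_⟩
  rw [coe_F]
  ext i j
  fin_cases i <;> fin_cases j <;> apply Complex.ext <;> simp [herm, -one_div]

lemma isHermReflection_A : IsHermReflection A 1 0 0 := by
  refine ⟨by norm_num, ?_⟩
  rw [coe_A]
  ext i j
  fin_cases i <;> fin_cases j <;> apply Complex.ext <;> simp [herm]

lemma isHermReflection_cj_F_Z : IsHermReflection (cj F Z) (1 / √2) 0 (1 / √2) := by
  refine isHermReflection_F.cj_of_smul coe_Z (by rw [inv_sqrt_two_sq]; norm_num) ?_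
  ext i j
  fin_cases i <;> fin_cases j <;> apply Complex.ext <;> simp [herm]

lemma isHermReflection_cj_F_Z_sq : IsHermReflection (cj F (Z ^ 2)) 0 (1 / √2) (1 / √2) := by
  have : cj F (Z ^ 2) = cj (cj F Z) Z := by
    simp only [cj, pow_two, _root_.mul_inv_rev, mul_assoc]
  rw [this]
  refine isHermReflection_cj_F_Z.cj_of_smul coe_Z (by rw [inv_sqrt_two_sq]; norm_num) ?_
  ext i j
  fin_cases i <;> fin_cases j <;> apply Complex.ext <;> simp [herm]

lemma R_sq : R ^ 2 = A := by
  apply Units.ext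
  rw [Units.val_pow_eq_pow_val, coe_R, coe_A, pow_two]
  ext i j
  fin_cases i <;> fin_cases j <;> simp

lemma isHermReflection_cj_A_Z : IsHermReflection (cj A Z) 0 0 1 := by
  refine isHermReflection_A.cj_of_smul coe_Z (by norm_num) ?_
  ext i j
  fin_cases i <;> fin_cases j <;> apply Complex.ext <;> simp [herm]

lemma isHermReflection_cj_A_M : IsHermReflection (cj A M) (τ / 2) (-1 / 2) (-σ / 2) := by
  have h := τ_sq
  refine isHermReflection_A.cj_of_smul coe_M (by rw [σ]; linarith) ?_
  ext i j
  fin_cases i <;> fin_cases j <;> apply Complex.ext <;> simp [herm, σ] <;> linarith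

lemma isHermReflectionSet_twelve : IsHermReflectionSet (shephardToddGens 12) := by
  rintro g (rfl | rfl | rfl)
  exacts [⟨_, _, _, isHermReflection_F⟩, ⟨_, _, _, isHermReflection_cj_F_Z⟩,
    ⟨_, _, _, isHermReflection_cj_F_Z_sq⟩]

lemma isHermReflectionSet_thirteen : IsHermReflectionSet (shephardToddGens 13) := by
  rintro g (rfl | rfl | rfl)
  exacts [⟨_, _, _, isHermReflection_F⟩, ⟨_, _, _, isHermReflection_cj_F_Z⟩,
    ⟨_, _, _, R_sq ▸ isHermReflection_A⟩]

lemma isHermReflectionSet_twentytwo : IsHermReflectionSet (shephardToddGens 22) := by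
  rintro g (rfl | rfl | rfl)
  exacts [⟨_, _, _, isHermReflection_A⟩, ⟨_, _, _, isHermReflection_cj_A_Z⟩,
    ⟨_, _, _, isHermReflection_cj_A_M⟩]

section Products

variable {g h k : GL (Fin 2) ℂ} {a x y a' x' y' a₂ x₂ y₂ : ℝ}

lemma coe_mul_of_isHermReflection (hg : IsHermReflection g a x y)
    (hh : IsHermReflection h a' x' y') : ((g * h : GL (Fin 2) ℂ) : Matrix (Fin 2) (Fin 2) ℂ) =
    !![⟨a * a' + x * x' + y * y', y * x' - x * y'⟩, ⟨a * x' - x * a', a * y' - y * a'⟩;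
      ⟨x * a' - a * x', a * y' - y * a'⟩, ⟨a * a' + x * x' + y * y', x * y' - y * x'⟩] := by
  rw [Units.val_mul, hg.2, hh.2, herm_mul_herm]

lemma offDiag_eq (hg : IsHermReflection g a x y) (hh : IsHermReflection h a' x' y') :
    offDiag g h = ⟨a * x' - x * a', a * y' - y * a'⟩ := by
  rw [offDiag, coe_mul_of_isHermReflection hg hh]
  simp

/-- The products `g h` and `g k` of reflections are a primitive pair if `g` is orthogonal to neither
`h` nor `k` and the three roots are linearly independent. -/
lemma IsPrimitivePair.of_isHermReflection (hg : IsHermReflection g a x y)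
    (hh : IsHermReflection h a' x' y') (hk : IsHermReflection k a₂ x₂ y₂)
    (h1 : a * a' + x * x' + y * y' ≠ 0) (h2 : a * a₂ + x * x₂ + y * y₂ ≠ 0)
    (h3 : a * (x' * y₂ - y' * x₂) + x * (y' * a₂ - a' * y₂) + y * (a' * x₂ - x' * a₂) ≠ 0) :
    IsPrimitivePair (g * h) (g * k) := by
  refine ⟨?_, ?_, ?_⟩
  · rw [coe_mul_of_isHermReflection hg hh]
    refine ne_zero_of_re ?_
    simpa [trace_fin_two, ← two_mul] using h1
  · rw [coe_mul_of_isHermReflection hg hk]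
    refine ne_zero_of_re ?_
    simpa [trace_fin_two, ← two_mul] using h2
  · rw [coe_mul_of_isHermReflection hg hh, coe_mul_of_isHermReflection hg hk]
    refine ne_zero_of_re ?_
    -- In terms of roots, the commutator corresponds to `2 (g × h) × (g × k) = 2 t g` up to sign,
    -- with `t` the triple product, so its determinant is `4 t²`.
    convert mul_ne_zero four_ne_zero (pow_ne_zero 2 h3) using 1
    · have := hg.1
      simp [det_fin_two]
      linear_combination 4 * (a * (x' * y₂ - y' * x₂) + x * (y' * a₂ - a' * y₂) +
        y * (a' * x₂ - x' * a₂)) ^ 2 * this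

end Products

lemma isSystemOfImprimitivity_iff {n : ℕ} (hn : n = 12 ∨ n = 13 ∨ n = 22)
    (𝒱 : Set (Submodule ℍ[ℝ]ᵐᵒᵖ (Fin 2 → ℍ[ℝ]))) :
    IsSystemOfImprimitivity (toQuat (shephardTodd n)) 𝒱 ↔
      ∃ z : ℂ, ‖z‖ = 1 ∧ 𝒱 = orthogonalSystem (mulJ z) := by
  have h2 := inv_sqrt_two_sq
  have h2' : 0 < 1 / √2 := by positivity
  have ht := τ_sq
  have ht' := one_lt_τ
  have mem : ∀ {S : Set (GL (Fin 2) ℂ)} {g h}, g ∈ S → h ∈ S → g * h ∈ Subgroup.closure S :=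
    fun hg hh => mul_mem (Subgroup.subset_closure hg) (Subgroup.subset_closure hh)
  rcases hn with rfl | rfl | rfl
  · have m0 : F ∈ shephardToddGens 12 := by simp [shephardToddGens]
    have m1 : cj F Z ∈ shephardToddGens 12 := by simp [shephardToddGens]
    have m2 : cj F (Z ^ 2) ∈ shephardToddGens 12 := by simp [shephardToddGens]
    refine isHermReflectionSet_twelve.isSystemOfImprimitivity_iff (mem m0 m1) (mem m0 m2)
      (.of_isHermReflection isHermReflection_F isHermReflection_cj_F_Z isHermReflection_cj_F_Z_sq
        ?_ ?_ ?_) m0 m1 m2 ?_ 𝒱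
    · nlinarith
    · nlinarith
    · have : 0 < (1 / √2) ^ 3 := by positivity
      nlinarith
    · rw [offDiag_eq isHermReflection_F isHermReflection_cj_F_Z,
        offDiag_eq isHermReflection_F isHermReflection_cj_F_Z_sq]
      have : 0 < (1 / √2) ^ 4 := by positivity
      dsimp only
      nlinarith
  · have m0 : F ∈ shephardToddGens 13 := by simp [shephardToddGens]
    have m1 : cj F Z ∈ shephardToddGens 13 := by simp [shephardToddGens]
    have m2 : A ∈ shephardToddGens 13 := by simp [shephardToddGens, R_sq]
    refine isHermReflectionSet_thirteen.isSystemOfImprimitivity_iff (mem m0 m1) (mem m0 m2)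
      (.of_isHermReflection isHermReflection_F isHermReflection_cj_F_Z isHermReflection_A
        ?_ ?_ ?_) m0 m1 m2 ?_ 𝒱
    · nlinarith
    · nlinarith
    · nlinarith
    · rw [offDiag_eq isHermReflection_F isHermReflection_cj_F_Z,
        offDiag_eq isHermReflection_F isHermReflection_A]
      have : 0 < (1 / √2) ^ 3 := by positivity
      dsimp only
      nlinarith
  · have m0 : A ∈ shephardToddGens 22 := by simp [shephardToddGens]
    have m1 : cj A Z ∈ shephardToddGens 22 := by simp [shephardToddGens]
    have m2 : cj A M ∈ shephardToddGens 22 := by simp [shephardToddGens]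
    -- The roots of `A` and `cj A Z` are orthogonal, so `cj A M` has to be the common factor.
    refine isHermReflectionSet_twentytwo.isSystemOfImprimitivity_iff (mem m2 m0) (mem m2 m1)
      (.of_isHermReflection isHermReflection_cj_A_M isHermReflection_A isHermReflection_cj_A_Z
        ?_ ?_ ?_) m0 m1 m2 ?_ 𝒱
    · nlinarith
    · rw [σ]
      nlinarith
    · norm_num
    · rw [offDiag_eq isHermReflection_A isHermReflection_cj_A_Z,
        offDiag_eq isHermReflection_A isHermReflection_cj_A_M]
      norm_num

/-! ### Unitary bases adapted to a system -/

section ChangeOfBasis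

variable {z : ℂ} {X Y : ℍ[ℝ]}

lemma star_mul_self_of_normSq (hX : normSq X = 1 / 2) :
    star X * X = ((1 / 2 : ℝ) : ℍ[ℝ]) ∧ X * star X = ((1 / 2 : ℝ) : ℍ[ℝ]) := by
  rw [star_mul_self, self_mul_star, hX]
  exact ⟨rfl, rfl⟩

lemma coe_half_add_half : ((1 / 2 : ℝ) : ℍ[ℝ]) + ((1 / 2 : ℝ) : ℍ[ℝ]) = 1 := by
  rw [← Quaternion.coe_add]
  norm_num

/-- The basis matrix with columns `(1, q) X` and `(q, 1) Y`. -/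
def basisMatrix (z : ℂ) (X Y : ℍ[ℝ]) : Matrix (Fin 2) (Fin 2) ℍ[ℝ] :=
  !![X, mulJ z * Y; mulJ z * X, Y]

lemma star_basisMatrix : star (basisMatrix z X Y) =
    !![star X, -(star X * mulJ z); -(star Y * mulJ z), star Y] := by
  ext1 i j
  fin_cases i <;> fin_cases j <;> simp [basisMatrix, star_apply, star_mulJ]

lemma star_mul_basisMatrix (hz : ‖z‖ = 1) (hX : normSq X = 1 / 2) (hY : normSq Y = 1 / 2) :
    star (basisMatrix z X Y) * basisMatrix z X Y = 1 := by
  have h : ∀ c, mulJ z * (mulJ z * c) = -c := fun c => by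
    rw [← mul_assoc, mulJ_mul_mulJ hz, neg_one_mul]
  have h1 := (star_mul_self_of_normSq hX).1
  have h2 := (star_mul_self_of_normSq hY).1
  rw [star_basisMatrix, basisMatrix, Matrix.mul_fin_two, Matrix.one_fin_two]
  simp only [neg_mul, mul_assoc, h, mul_neg, neg_neg, h1, h2, coe_half_add_half, add_neg_cancel,
    neg_add_cancel]

lemma basisMatrix_mul_star (hz : ‖z‖ = 1) (hX : normSq X = 1 / 2) (hY : normSq Y = 1 / 2) :
    basisMatrix z X Y * star (basisMatrix z X Y) = 1 := by
  have h1 : ∀ c, X * (star X * c) = ((1 / 2 : ℝ) : ℍ[ℝ]) * c := fun c => by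
    rw [← mul_assoc, (star_mul_self_of_normSq hX).2]
  have h2 : ∀ c, Y * (star Y * c) = ((1 / 2 : ℝ) : ℍ[ℝ]) * c := fun c => by
    rw [← mul_assoc, (star_mul_self_of_normSq hY).2]
  have h3 : mulJ z * ((1 / 2 : ℝ) : ℍ[ℝ]) = ((1 / 2 : ℝ) : ℍ[ℝ]) * mulJ z :=
    (Quaternion.coe_commutes _ _).symm
  rw [star_basisMatrix, basisMatrix, Matrix.mul_fin_two, Matrix.one_fin_two]
  simp only [mul_assoc, mul_neg, h1, h2, (star_mul_self_of_normSq hX).2,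
    (star_mul_self_of_normSq hY).2, h3]
  simp only [← mul_assoc, h3]
  simp only [mul_assoc, mulJ_mul_mulJ hz, mul_neg, mul_one, neg_neg, coe_half_add_half,
    add_neg_cancel, neg_add_cancel]

/-- The diagonal vanishes because `g` swaps two orthogonal lines. -/
lemma basisMatrix_conj (hz : ‖z‖ = 1) {g : GL (Fin 2) ℂ} {a x y : ℝ}
    (hg : IsHermReflection g a x y) :
    star (basisMatrix z X Y) * (quatHom g : Matrix (Fin 2) (Fin 2) ℍ[ℝ]) * basisMatrix z X Y =
      !![0, (2 : ℝ) • (star X * (quat x y 0 0 + a • mulJ z) * Y);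
        star ((2 : ℝ) • (star X * (quat x y 0 0 + a • mulJ z) * Y)), 0] := by
  have h0 := mulJ_mul_mulJ hz
  have h : ∀ c, mulJ z * (mulJ z * c) = -c := fun c => by rw [← mul_assoc, h0, neg_one_mul]
  have hb : ((⟨x, y⟩ : ℂ) : ℍ[ℝ]) = quat x y 0 0 := by ext <;> simp
  have hb' : ((⟨x, -y⟩ : ℂ) : ℍ[ℝ]) = star (quat x y 0 0) := by ext <;> simp
  have ha : ((⟨a, 0⟩ : ℂ) : ℍ[ℝ]) = (a : ℍ[ℝ]) := by ext <;> simp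
  have ha' : ((⟨-a, 0⟩ : ℂ) : ℍ[ℝ]) = -(a : ℍ[ℝ]) := by ext <;> simp
  have hq : ∀ c, mulJ z * (quat x y 0 0 * c) = star (quat x y 0 0) * (mulJ z * c) := fun c => by
    rw [← mul_assoc, ← hb, mulJ_mul_coe, mul_assoc, hb, ← hb']
    congr 3
  have hq' : ∀ c, mulJ z * (star (quat x y 0 0) * c) = quat x y 0 0 * (mulJ z * c) := fun c => by
    rw [← mul_assoc, ← hb', mulJ_mul_coe, mul_assoc, ← hb]
    congr 3
    apply Complex.ext <;> simp
  rw [star_basisMatrix, basisMatrix, coe_quatHom, hg.2]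
  simp only [herm, Matrix.of_apply, Matrix.cons_val_zero, Matrix.cons_val_one, hb, hb', ha, ha',
    Matrix.mul_fin_two]
  have hcomm : ∀ c, mulJ z * ((a : ℍ[ℝ]) * c) = (a : ℍ[ℝ]) * (mulJ z * c) := fun c => by
    rw [← mul_assoc, ← Quaternion.coe_commutes, mul_assoc]
  rw [← Quaternion.coe_mul_eq_smul a]
  simp only [mul_add, add_mul, mul_assoc, neg_mul, mul_neg, hq, hq', hcomm, h, smul_add, star_add,
    neg_neg, StarMul.star_mul, star_star, Quaternion.star_smul, star_mulJ,
    Quaternion.star_coe, smul_neg]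
  ext1 i j
  fin_cases i <;> fin_cases j <;> simp <;> module

/-- Every pair of quaternions of the same norm gives a change of basis matrix. -/
lemma exists_isChangeOfBasis_of_normSq (hz : ‖z‖ = 1) (hX : normSq X = 1 / 2)
    (hY : normSq Y = 1 / 2) :
    ∃ U : GL (Fin 2) ℍ[ℝ], IsChangeOfBasis (mulJ z) U ∧ ∀ g a x y, IsHermReflection g a x y →
      ((U⁻¹ * quatHom g * U : GL (Fin 2) ℍ[ℝ]) : Matrix (Fin 2) (Fin 2) ℍ[ℝ]) =
      !![0, (2 : ℝ) • (star X * (quat x y 0 0 + a • mulJ z) * Y);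
        star ((2 : ℝ) • (star X * (quat x y 0 0 + a • mulJ z) * Y)), 0] := by
  refine ⟨⟨basisMatrix z X Y, star (basisMatrix z X Y), basisMatrix_mul_star hz hX hY,
    star_mul_basisMatrix hz hX hY⟩, ⟨?_, ?_, ?_⟩, fun g a x y hg => basisMatrix_conj hz hg⟩
  · exact ⟨star_mul_basisMatrix hz hX hY, basisMatrix_mul_star hz hX hY⟩
  · refine mem_line_iff.2 ⟨X, ?_⟩
    ext1 i
    fin_cases i <;> simp [basisMatrix]
  · refine mem_line_iff.2 ⟨Y, ?_⟩
    rw [star_mulJ, neg_neg]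
    ext1 i
    fin_cases i <;> simp [basisMatrix]

/-- Reduction to `z = 1`: if `c² = z` then `c̄ (x + y i + a z j) c = x + y i + a j`. Replacing `X`,
`Y` by `c X`, `c Y`, scaled to norm square `1/2`, makes one choice of `X` and `Y` serve all `z`. -/
lemma exists_isChangeOfBasis (hz : ‖z‖ = 1) {N : ℝ} (hN : 0 < N) (hX : normSq X = N)
    (hY : normSq Y = N) :
    ∃ U : GL (Fin 2) ℍ[ℝ], IsChangeOfBasis (mulJ z) U ∧ ∀ g a x y, IsHermReflection g a x y →
      ∀ b : ℍ[ℝ],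
      star X * quat x y a 0 * Y = N • b →
      ((U⁻¹ * quatHom g * U : GL (Fin 2) ℍ[ℝ]) : Matrix (Fin 2) (Fin 2) ℍ[ℝ]) =
      !![0, b; star b, 0] := by
  obtain ⟨c, hc⟩ := IsAlgClosed.exists_pow_nat_eq z (n := 2) two_pos
  have hc1 : ‖c‖ = 1 := by
    have : ‖c‖ ^ 2 = 1 := by rw [← norm_pow, hc, hz]
    exact (pow_eq_one_iff_of_nonneg (norm_nonneg _) two_ne_zero).1 this
  have hcn : normSq (c : ℍ[ℝ]) = 1 := by
    have h1 := Complex.normSq_eq_norm_sq c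
    rw [hc1, Complex.normSq_apply] at h1
    rw [Quaternion.normSq_def']
    simp
    linarith
  have hs : ∀ W : ℍ[ℝ], normSq W = N → normSq ((1 / √(2 * N)) • ((c : ℍ[ℝ]) * W)) = 1 / 2 :=
    fun W hW => by
      rw [normSq_smul, map_mul, hcn, hW, div_pow, Real.sq_sqrt (by positivity)]
      field_simp
  obtain ⟨U, hU, h⟩ := exists_isChangeOfBasis_of_normSq hz (hs X hX) (hs Y hY)
  refine ⟨U, hU, fun g a x y hg b hb => ?_⟩
  have hconj : star (c : ℍ[ℝ]) * (quat x y 0 0 + a • mulJ z) * c = quat x y a 0 := by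
    have h1 : c.re ^ 2 + c.im ^ 2 = 1 := by
      have := Complex.normSq_eq_norm_sq c
      rw [hc1, Complex.normSq_apply] at this
      linarith
    rw [mulJ_eq, ← hc]
    ext <;> simp [pow_two]
    · linear_combination x * h1
    · linear_combination y * h1
    · linear_combination a * (c.re ^ 2 + c.im ^ 2 + 1) * h1
    · ring
  have : (2 : ℝ) • (star ((1 / √(2 * N)) • ((c : ℍ[ℝ]) * X)) * (quat x y 0 0 + a • mulJ z) *
      ((1 / √(2 * N)) • ((c : ℍ[ℝ]) * Y))) = b := by
    have e : star ((c : ℍ[ℝ]) * X) * (quat x y 0 0 + a • mulJ z) * ((c : ℍ[ℝ]) * Y) = N • b := by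
      rw [← hb, ← hconj, StarMul.star_mul]
      simp only [mul_assoc]
    rw [Quaternion.star_smul, smul_mul_assoc, smul_mul_assoc, mul_smul_comm, e, smul_smul,
      smul_smul, smul_smul]
    have h2 : 1 / √(2 * N) * (1 / √(2 * N)) = 1 / (2 * N) := by
      rw [← pow_two, div_pow, Real.sq_sqrt (by positivity), one_pow]
    have h3 : 2 * (1 / √(2 * N)) * (1 / √(2 * N)) * N = 1 := by
      rw [mul_assoc 2, h2]
      field_simp
    rw [h3, one_smul]
  rw [h g a x y hg, this]

end ChangeOfBasis

/-! ### Recognising the groups `G_K(L, 1)` -/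

/-- The group `G_K(L, 1)` is generated by the reflections that belong to generators of `L`. -/
lemma imprimitiveGroup_reflectionSystem {S : Set ℍ[ℝ]} (hS : ∀ s ∈ S, normSq s = 1)
    {T : Subgroup (GL (Fin 2) ℍ[ℝ])}
    (h : ∀ s ∈ S, ∃ g ∈ T, (g : Matrix (Fin 2) (Fin 2) ℍ[ℝ]) = !![0, s; star s, 0])
    (hT : T ≤ Subgroup.closure
      {g : GL (Fin 2) ℍ[ℝ] | ∃ s ∈ S, (g : Matrix (Fin 2) (Fin 2) ℍ[ℝ]) = !![0, s; star s, 0]}) :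
    imprimitiveGroup (reflectionSystem S) {1} = T := by
  have key : ∀ b ∈ reflectionSystem S, normSq b = 1 ∧
      ∃ g ∈ T, (g : Matrix (Fin 2) (Fin 2) ℍ[ℝ]) = !![0, b; star b, 0] := fun b hb => by
    induction hb with
    | of hs => exact ⟨hS _ hs, h _ hs⟩
    | @circ a b _ _ iha ihb =>
      obtain ⟨ha, g, hg, hga⟩ := iha
      obtain ⟨hb, k, hk, hkb⟩ := ihb
      have hinv : b⁻¹ = star b := inv_eq_of_mul_eq_one_right (by rw [self_mul_star, hb]; simp)
      refine ⟨by simp [ha, hb], g * k * g, T.mul_mem (T.mul_mem hg hk) hg, ?_⟩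
      rw [Units.val_mul, Units.val_mul, hga, hkb, hinv, Matrix.mul_fin_two, Matrix.mul_fin_two]
      simp [mul_assoc]
  refine le_antisymm ?_ (hT.trans (Subgroup.closure_mono ?_))
  · rw [imprimitiveGroup, Subgroup.closure_le]
    rintro g (⟨b, hb, hgb⟩ | ⟨b, hb, -⟩)
    · obtain ⟨-, k, hk, hkb⟩ := key b hb
      rwa [show g = k from Units.ext (hgb.trans hkb.symm)]
    · simp at hb
  · rintro g ⟨s, hs, hgs⟩
    exact Or.inl ⟨s, .of hs, hgs⟩

/-- If a complex group is generated by reflections `g i` that a change of basis turns into the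
reflections belonging to `s i`, then it turns the group into `G_K(L, 1)`, where the `s i` generate
`L`. -/
lemma changeBasis_eq_imprimitiveGroup {ι : Type*} {s : ι → ℍ[ℝ]} (hs : ∀ i, normSq (s i) = 1)
    {G : Set (GL (Fin 2) ℂ)} {g : ι → GL (Fin 2) ℂ} {U : GL (Fin 2) ℍ[ℝ]}
    (hg : ∀ i, g i ∈ Subgroup.closure G) (hG : ∀ h ∈ G, h ∈ Subgroup.closure (Set.range g))
    (hU : ∀ i, ((U⁻¹ * quatHom (g i) * U : GL (Fin 2) ℍ[ℝ]) : Matrix (Fin 2) (Fin 2) ℍ[ℝ]) =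
      !![0, s i; star (s i), 0]) :
    changeBasis U (toQuat (Subgroup.closure G)) =
      imprimitiveGroup (reflectionSystem (Set.range s)) {1} := by
  symm
  refine imprimitiveGroup_reflectionSystem (Set.forall_mem_range.2 hs)
    (Set.forall_mem_range.2 fun i => ⟨U⁻¹ * quatHom (g i) * U, ?_, hU i⟩) ?_
  · exact ⟨_, Subgroup.mem_map_of_mem quatHom (hg i), by simp⟩
  · have : Subgroup.closure G ≤ Subgroup.closure (Set.range g) := (Subgroup.closure_le _).2 hG
    refine (Subgroup.map_mono (Subgroup.map_mono this)).trans ?_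
    rw [MonoidHom.map_closure, MonoidHom.map_closure]
    refine Subgroup.closure_mono ?_
    rintro _ ⟨_, ⟨_, ⟨i, rfl⟩, rfl⟩, rfl⟩
    refine ⟨s i, ⟨i, rfl⟩, ?_⟩
    rw [← hU i]
    simp [quatHom]

/-- A group generated by Hermitian reflections becomes `G_K(L, 1)` in a suitable basis, if left
and right multiplication by quaternions `X̄` and `Y` of the same norm takes the roots to generators
of `L`. -/
lemma exists_changeBasis_eq_imprimitiveGroup {ι : Type*} {s : ι → ℍ[ℝ]}
    (hs : ∀ i, normSq (s i) = 1) {G : Set (GL (Fin 2) ℂ)} {g : ι → GL (Fin 2) ℂ} {a x y : ι → ℝ}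
    (hg : ∀ i, g i ∈ Subgroup.closure G) (hG : ∀ h ∈ G, h ∈ Subgroup.closure (Set.range g))
    (href : ∀ i, IsHermReflection (g i) (a i) (x i) (y i)) {X Y : ℍ[ℝ]} {N : ℝ} (hN : 0 < N)
    (hX : normSq X = N) (hY : normSq Y = N)
    (hXY : ∀ i, star X * quat (x i) (y i) (a i) 0 * Y = N • s i) {z : ℂ} (hz : ‖z‖ = 1) :
    ∃ U : GL (Fin 2) ℍ[ℝ], IsChangeOfBasis (mulJ z) U ∧
      changeBasis U (toQuat (Subgroup.closure G)) =
        imprimitiveGroup (reflectionSystem (Set.range s)) {1} := by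
  obtain ⟨U, hU, h⟩ := exists_isChangeOfBasis hz hN hX hY
  exact ⟨U, hU, changeBasis_eq_imprimitiveGroup hs hg hG
    fun i => h _ _ _ _ (href i) _ (hXY i)⟩

/-! ### Matching roots with generators of `L` -/

lemma L12T_eq : L12T = reflectionSystem
    (Set.range ![1, quat 0 1 0 0, quat (1 / 2) (1 / 2) (1 / 2) (1 / 2)]) := by
  simp only [Matrix.range_cons, Matrix.range_empty, Set.union_empty, Set.singleton_union]
  rfl

lemma L18O_eq : L18O = reflectionSystem
    (Set.range ![1, quat (1 / √2) (1 / √2) 0 0, quat (1 / 2) (1 / 2) (1 / 2) (1 / 2)]) := by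
  simp only [Matrix.range_cons, Matrix.range_empty, Set.union_empty, Set.singleton_union]
  rfl

lemma L30I_eq : L30I = reflectionSystem (Set.range
    ![1, quat (1 / 2) (1 / 2) (1 / 2) (1 / 2), quat (τ / 2) (σ / 2) (-1 / 2) 0]) := by
  simp only [Matrix.range_cons, Matrix.range_empty, Set.union_empty, Set.singleton_union]
  rfl

lemma IsHermReflection.congr {g : GL (Fin 2) ℂ} {a x y a' x' y' : ℝ}
    (h : IsHermReflection g a x y) (ha : a = a') (hx : x = x') (hy : y = y') :
    IsHermReflection g a' x' y' := by
  subst ha hx hy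
  exact h

/-- The given generators have pairwise root products `1/2`; this root is orthogonal to that of `F`,
as `i` is to `1`. -/
lemma isHermReflection_twelve : IsHermReflection (cj F Z * cj F (Z ^ 2) * cj F Z)
    (1 / √2) (-(1 / √2)) 0 := by
  have h := inv_sqrt_two_sq
  refine (isHermReflection_cj_F_Z.conj isHermReflection_cj_F_Z_sq).congr ?_ ?_ ?_
  · linear_combination 2 * (1 / √2) * h
  · ring
  · linear_combination 2 * (1 / √2) * h

lemma exists_changeBasis_twelve {z : ℂ} (hz : ‖z‖ = 1) :
    ∃ U : GL (Fin 2) ℍ[ℝ], IsChangeOfBasis (mulJ z) U ∧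
      changeBasis U (toQuat (shephardTodd 12)) = imprimitiveGroup L12T {1} := by
  have h := inv_sqrt_two_sq
  have m0 : F ∈ shephardTodd 12 := Subgroup.subset_closure (by simp [shephardToddGens])
  have m1 : cj F Z ∈ shephardTodd 12 := Subgroup.subset_closure (by simp [shephardToddGens])
  have m2 : cj F (Z ^ 2) ∈ shephardTodd 12 := Subgroup.subset_closure (by simp [shephardToddGens])
  rw [L12T_eq]
  -- Write `vᵢ = xᵢ + yᵢ i + aᵢ j`. As `s₀ = 1`, necessarily `Y = v̄₀ X`, and `X` is chosen so that
  -- `p ↦ X̄ p X / N` rotates `vᵢ v̄₀` to `sᵢ`.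
  refine exists_changeBasis_eq_imprimitiveGroup (ι := Fin 3)
    (g := ![F, cj F Z * cj F (Z ^ 2) * cj F Z, cj F Z])
    (a := ![1 / √2, 1 / √2, 1 / √2]) (x := ![1 / √2, -(1 / √2), 0]) (y := ![0, 0, 1 / √2])
    (X := quat 0 (2 * (1 / √2)) (2 * (1 / √2)) 0) (Y := quat 1 1 1 1) (N := 4)
    ?_ ?_ ?_ ?_ (by norm_num) ?_ ?_ ?_ hz
  · intro i
    rw [Quaternion.normSq_def']
    fin_cases i <;> norm_num
  · intro i
    fin_cases i
    exacts [m0, mul_mem (mul_mem m1 m2) m1, m1]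
  · set G := ![F, cj F Z * cj F (Z ^ 2) * cj F Z, cj F Z]
    have n0 := Subgroup.subset_closure (Set.mem_range_self (f := G) 0)
    have n1 := Subgroup.subset_closure (Set.mem_range_self (f := G) 1)
    have n2 := Subgroup.subset_closure (Set.mem_range_self (f := G) 2)
    rintro g (rfl | rfl | rfl)
    · exact n0
    · exact n2
    · have := mul_mem (mul_mem n2 n1) n2
      convert this using 1
      have h1 := isHermReflection_cj_F_Z.mul_self
      change _ = cj F Z * (cj F Z * cj F (Z ^ 2) * cj F Z) * cj F Z
      rw [mul_assoc, mul_assoc, mul_assoc, h1, mul_one, ← mul_assoc, h1, one_mul]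
  · intro i
    fin_cases i
    exacts [isHermReflection_F, isHermReflection_twelve, isHermReflection_cj_F_Z]
  · rw [Quaternion.normSq_def']
    simp only [quat_re, quat_imI, quat_imJ, quat_imK]
    linear_combination 8 * h
  · rw [Quaternion.normSq_def']
    norm_num
  · generalize 1 / √2 = r at h
    intro i
    fin_cases i <;> ext <;> simp <;> linarith

lemma exists_changeBasis_thirteen {z : ℂ} (hz : ‖z‖ = 1) :
    ∃ U : GL (Fin 2) ℍ[ℝ], IsChangeOfBasis (mulJ z) U ∧
      changeBasis U (toQuat (shephardTodd 13)) = imprimitiveGroup L18O {1} := by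
  have h := inv_sqrt_two_sq
  have m0 : F ∈ shephardTodd 13 := Subgroup.subset_closure (by simp [shephardToddGens])
  have m1 : cj F Z ∈ shephardTodd 13 := Subgroup.subset_closure (by simp [shephardToddGens])
  have m2 : A ∈ shephardTodd 13 := Subgroup.subset_closure (by simp [shephardToddGens, R_sq])
  rw [L18O_eq]
  -- In this order the root products are `1/√2`, `1/2`, `1/√2`, as for the generators of `L`. The
  -- roots of `F` and `cj F Z` play the same roles as for `G₁₂`, so the same `X` and `Y` work.
  refine exists_changeBasis_eq_imprimitiveGroup (ι := Fin 3) (g := ![F, A, cj F Z])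
    (a := ![1 / √2, 1, 1 / √2]) (x := ![1 / √2, 0, 0]) (y := ![0, 0, 1 / √2])
    (X := quat 0 (2 * (1 / √2)) (2 * (1 / √2)) 0) (Y := quat 1 1 1 1) (N := 4)
    ?_ ?_ ?_ ?_ (by norm_num) ?_ ?_ ?_ hz
  · intro i
    rw [Quaternion.normSq_def']
    generalize 1 / √2 = r at h
    fin_cases i <;> simp <;> linarith
  · intro i
    fin_cases i
    exacts [m0, m2, m1]
  · set G := ![F, A, cj F Z]
    rintro g (rfl | rfl | rfl)
    · exact Subgroup.subset_closure (Set.mem_range_self (f := G) 0)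
    · exact Subgroup.subset_closure (Set.mem_range_self (f := G) 2)
    · rw [R_sq]
      exact Subgroup.subset_closure (Set.mem_range_self (f := G) 1)
  · intro i
    fin_cases i
    exacts [isHermReflection_F, isHermReflection_A, isHermReflection_cj_F_Z]
  · rw [Quaternion.normSq_def']
    simp only [quat_re, quat_imI, quat_imJ, quat_imK]
    linear_combination 8 * h
  · rw [Quaternion.normSq_def']
    norm_num
  · generalize 1 / √2 = r at h
    intro i
    fin_cases i <;> ext <;> simp <;> linarith

lemma isHermReflection_twentytwo : IsHermReflection (cj A M * cj A Z * cj A M)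
    (1 / 2) (σ / 2) (-τ / 2) := by
  have h := τ_sq
  refine (isHermReflection_cj_A_M.conj isHermReflection_cj_A_Z).congr ?_ ?_ ?_ <;>
    rw [σ] <;> linarith

/-- This is `-cj A Z`; the sign makes the product with the root of `isHermReflection_twentytwo`
equal to `τ / 2`, not `-τ / 2`. -/
lemma isHermReflection_twentytwo' : IsHermReflection (A * cj A Z * A) 0 0 (-1) := by
  refine (isHermReflection_A.conj isHermReflection_cj_A_Z).congr ?_ ?_ ?_ <;> norm_num

/-- Shows that the new generating reflections recover `cj A M`; both sides are reflections, so
comparing roots suffices. -/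
lemma cj_A_M_eq : cj A M = cj A M * cj A Z * cj A M * (A * cj A Z * A * (cj A M * cj A Z * cj A M) *
    (A * cj A Z * A)) * (cj A M * cj A Z * cj A M) := by
  have h := τ_sq
  have h3 : τ ^ 3 = 2 * τ + 1 := by linear_combination (τ + 1) * h
  refine isHermReflection_cj_A_M.eq (isHermReflection_twentytwo.conj
    (isHermReflection_twentytwo'.conj isHermReflection_twentytwo)) ?_ ?_ ?_ <;>
    rw [σ] <;> linarith

lemma exists_changeBasis_twentytwo {z : ℂ} (hz : ‖z‖ = 1) :
    ∃ U : GL (Fin 2) ℍ[ℝ], IsChangeOfBasis (mulJ z) U ∧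
      changeBasis U (toQuat (shephardTodd 22)) = imprimitiveGroup L30I {1} := by
  have h := τ_sq
  have h3 : τ ^ 3 = 2 * τ + 1 := by linear_combination (τ + 1) * h
  have m0 : A ∈ shephardTodd 22 := Subgroup.subset_closure (by simp [shephardToddGens])
  have m1 : cj A Z ∈ shephardTodd 22 := Subgroup.subset_closure (by simp [shephardToddGens])
  have m2 : cj A M ∈ shephardTodd 22 := Subgroup.subset_closure (by simp [shephardToddGens])
  rw [L30I_eq]
  -- The root products `1/2`, `τ/2`, `0` agree with those of the generators of `L`. Again `Y = v̄₀
  -- X`, and `N` is the common norm square, simplified by `τ² = τ + 1`.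
  refine exists_changeBasis_eq_imprimitiveGroup (ι := Fin 3)
    (g := ![cj A M * cj A Z * cj A M, A, A * cj A Z * A])
    (a := ![1 / 2, 1, 0]) (x := ![σ / 2, 0, 0]) (y := ![-τ / 2, 0, -1])
    (X := quat (τ - 1) (1 - τ) (3 - τ) (1 - τ)) (Y := quat 1 1 (3 - 2 * τ) 1) (N := 16 - 8 * τ)
    ?_ ?_ ?_ ?_ (by linarith [τ_lt_two]) ?_ ?_ ?_ hz
  · intro i
    rw [Quaternion.normSq_def', σ]
    fin_cases i <;> simp <;> linarith
  · intro i
    fin_cases i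
    exacts [mul_mem (mul_mem m2 m1) m2, m0, mul_mem (mul_mem m0 m1) m0]
  · set G := ![cj A M * cj A Z * cj A M, A, A * cj A Z * A]
    have n0 := Subgroup.subset_closure (Set.mem_range_self (f := G) 0)
    have n1 := Subgroup.subset_closure (Set.mem_range_self (f := G) 1)
    have n2 := Subgroup.subset_closure (Set.mem_range_self (f := G) 2)
    rintro g (rfl | rfl | rfl)
    · exact n1
    · have := mul_mem (mul_mem n1 n2) n1
      convert this using 1
      have h1 := isHermReflection_A.mul_self
      change _ = A * (A * cj A Z * A) * A
      rw [mul_assoc, mul_assoc, mul_assoc, h1, mul_one, ← mul_assoc, h1, one_mul]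
    · rw [cj_A_M_eq]
      exact mul_mem (mul_mem n0 (mul_mem (mul_mem n2 n0) n2)) n0
  · intro i
    fin_cases i
    exacts [isHermReflection_twentytwo, isHermReflection_A, isHermReflection_twentytwo']
  · rw [Quaternion.normSq_def']
    simp only [quat_re, quat_imI, quat_imJ, quat_imK]
    linarith
  · rw [Quaternion.normSq_def']
    simp only [quat_re, quat_imI, quat_imJ, quat_imK]
    linarith
  · rw [σ]
    intro i
    fin_cases i <;> ext <;> simp <;> linarith

end QuatImprim

end

theorem mainTheorem1 :
    -- a conjugate of `Gₙ`, `4 ≤ n ≤ 22`, has a quaternionic system of imprimitivity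
    -- if and only if `n` is `12`, `13` or `22`
    (∀ n : ℕ, 4 ≤ n → n ≤ 22 → ∀ P : GL (Fin 2) ℂ,
      ((∃ 𝒱, QuatImprim.IsSystemOfImprimitivity
          (QuatImprim.toQuat (QuatImprim.changeBasis P (QuatImprim.shephardTodd n))) 𝒱) ↔
        n = 12 ∨ n = 13 ∨ n = 22)) ∧
    -- all the quaternionic systems of imprimitivity of `G₁₂`, `G₁₃`, `G₂₂`
    (∀ n : ℕ, n = 12 ∨ n = 13 ∨ n = 22 → ∀ 𝒱,
      (QuatImprim.IsSystemOfImprimitivity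
          (QuatImprim.toQuat (QuatImprim.shephardTodd n)) 𝒱 ↔
        ∃ z : ℂ, ‖z‖ = 1 ∧ 𝒱 = QuatImprim.orthogonalSystem (QuatImprim.mulJ z))) ∧
    -- each of these systems turns them into imprimitive quaternionic reflection groups
    (∀ z : ℂ, ‖z‖ = 1 →
      (∃ U, QuatImprim.IsChangeOfBasis (QuatImprim.mulJ z) U ∧
        QuatImprim.changeBasis U (QuatImprim.toQuat (QuatImprim.shephardTodd 12)) =
          QuatImprim.imprimitiveGroup QuatImprim.L12T {1}) ∧
      (∃ U, QuatImprim.IsChangeOfBasis (QuatImprim.mulJ z) U ∧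
        QuatImprim.changeBasis U (QuatImprim.toQuat (QuatImprim.shephardTodd 13)) =
          QuatImprim.imprimitiveGroup QuatImprim.L18O {1}) ∧
      (∃ U, QuatImprim.IsChangeOfBasis (QuatImprim.mulJ z) U ∧
        QuatImprim.changeBasis U (QuatImprim.toQuat (QuatImprim.shephardTodd 22)) =
          QuatImprim.imprimitiveGroup QuatImprim.L30I {1})) := by
  refine ⟨fun n h4 h22 P => ⟨fun ⟨𝒱, h⟩ => ?_, fun hn => ?_⟩,
    fun n hn 𝒱 => QuatImprim.isSystemOfImprimitivity_iff hn 𝒱,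
    fun z hz => ⟨QuatImprim.exists_changeBasis_twelve hz, QuatImprim.exists_changeBasis_thirteen hz,
      QuatImprim.exists_changeBasis_twentytwo hz⟩⟩
  · by_contra hn
    exact QuatImprim.not_isSystemOfImprimitivity h4 h22 hn P 𝒱 h
  -- Any unit `z` would do; the system for `z = 1` is transported along `P`.
  · have h := (QuatImprim.isSystemOfImprimitivity_iff hn _).2 ⟨1, norm_one, rfl⟩
    rw [QuatImprim.changeBasis_toQuat]
    exact ⟨_, h.map _⟩
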